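/- Let $\pi\colon E\to M$ be a fibred manifold (a surjective smooth submersion) with $\dim M=n$, $\dim E=n+m$, let $r,k\ge 0$, and let $J^r\pi$ be the manifold of $r$-jets of local sections $s$ of $\pi$, with $\pi^{r+1}_r\colon J^{r+1}\pi\to J^r\pi$ the natural projection. For $\theta=j_{r+1}s(x)\in J^{r+1}\pi$ put $V_\theta=T_{j_rs(x)}J^r\pi$ and let $$D_{r+1}(\theta)=T_x(j_rs)\circ T_{j_rs(x)}\pi^r\colon V_\theta\to V_\theta,\qquad \omega_{r+1}(\theta)=\mathrm{id}-D_{r+1}(\theta),$$ where $\pi^r\colon J^r\pi\to M$ is the projection ($D_{r+1}(\theta)$ depends only on $\theta$). Let $\mathcal F_{r+1}=C^\infty(J^{r+1}\pi)$, and let $\Lambda^k_{r+1,r}$ be the $\mathcal F_{r+1}$-module of smooth $k$-forms on $J^{r+1}\pi$ along $\pi^{r+1}_r$, i.e. of smooth sections over $J^{r+1}\pi$ of the bundle with fibres $\wedge^kV_\theta^*$. Let $C^*_\theta=\{\beta\circ\omega_{r+1}(\theta):\beta\in V_\theta^*\}\subset V_\theta^*$ and let $H^*_\theta\subset V_\theta^*$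 be the image of $T^*_xM$ under pull-back by $T\pi^r$. Denote by $\mathcal C^p\Lambda^p_{r+1,r}$, $\mathcal H\Lambda^l_{r+1,r}$ and $\mathcal C^{p}\Lambda^{p}_{r+1,r}\wedge\mathcal H\Lambda^l_{r+1}$ the $\mathcal F_{r+1}$-submodules of those forms in $\Lambda^p_{r+1,r}$, $\Lambda^l_{r+1,r}$, $\Lambda^{p+l}_{r+1,r}$ whose value at every $\theta$ lies in $\wedge^pC^*_\theta$, in $\wedge^lH^*_\theta$, and in the linear span $\wedge^pC^*_\theta\wedge\wedge^lH^*_\theta$ of the wedge products of elements of these two spaces, respectively. Endomorphisms $A_1,\dots,A_k$ of a finite-dimensional vector space $V$ act on $\wedge^kV^*$ by $$\big((A_1\odot\cdots\odot A_k)\alpha\big)(v_1,\dots,v_k)=\frac1{k!}\sum_{\sigma\in S_k}\alpha(A_{\sigma(1)}v_1,\dots,A_{\sigma(k)}v_k).$$ Then $\Lambda^1_{r+1,r}=\mathcal C^1\Lambda^1_{r+1,r}\oplus\mathcal H\Lambda^1_{r+1,r}$, and $$\Lambda^k_{r+1,r}=\bigoplus_{l=0}^k\mathcal C^{k-l}\Lambda^{k-l}_{r+1,r}\wedge\mathcal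 H\Lambda^l_{r+1}$$ as $\mathcal F_{r+1}$-modules. For $0\le l\le k$ the projection $p_{k-l,l}$ of this direct sum onto its $l$-th summand is $$p_{k-l,l}=\binom{k}{k-l}\,\odot_{k-l}\,\omega_{r+1}\odot\odot_l\, D_{r+1},$$ that is, $(p_{k-l,l}\alpha)(\theta)=\binom{k}{k-l}\big(\underbrace{\omega_{r+1}(\theta)\odot\cdots\odot\omega_{r+1}(\theta)}_{k-l}\odot\underbrace{D_{r+1}(\theta)\odot\cdots\odot D_{r+1}(\theta)}_{l}\big)\alpha(\theta)$. -/

import Mathlib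

open Set Filter Topology
open scoped Manifold ContDiff

set_option linter.unusedSectionVars false

noncomputable section

section Analytic

theorem jetAux_iteratedFDeriv_succ_succ {X Y : Type*} [NormedAddCommGroup X] [NormedSpace ℝ X]
    [NormedAddCommGroup Y] [NormedSpace ℝ Y] {f : X → Y} {x : X} (k : ℕ)
    (hf : ContDiffAt ℝ ∞ f x) (w : Fin (k + 2) → X) :
    iteratedFDeriv ℝ (k + 2) f x w =
      fderiv ℝ (fderiv ℝ (iteratedFDeriv ℝ k f)) x (w 0) (w 1) (fun j => w j.succ.succ) := by
  have hg : ContDiffAt ℝ 2 (iteratedFDeriv ℝ k f) x :=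
    hf.iteratedFDeriv_right (m := 2) (by
      rw [show ((2 : WithTop ℕ∞) + (k : WithTop ℕ∞)) = ((2 + k : ℕ) : WithTop ℕ∞) by
        push_cast; rfl]
      exact (WithTop.coe_le_coe.2 (le_top : ((2 + k : ℕ) : ℕ∞) ≤ ⊤)))
  have hd : DifferentiableAt ℝ (fderiv ℝ (iteratedFDeriv ℝ k f)) x :=
    (hg.fderiv_right (m := 1) (by norm_num)).differentiableAt (by simp)
  have hd1 : DifferentiableAt ℝ (iteratedFDeriv ℝ (k + 1) f) x :=
    (hf.iteratedFDeriv_right (m := 1) (i := k + 1)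
      (by exact_mod_cast le_top)).differentiableAt (by simp)
  rw [iteratedFDeriv_succ_apply_left, ← fderiv_continuousMultilinear_apply_const_apply hd1]
  have h1 : (fun y => iteratedFDeriv ℝ (k + 1) f y (Fin.tail w)) =
      fun y => fderiv ℝ (iteratedFDeriv ℝ k f) y (w 1) (fun j => w j.succ.succ) := by
    ext1 y
    rw [iteratedFDeriv_succ_apply_left]
    rfl
  rw [h1]
  have hd2 : DifferentiableAt ℝ (fun y => fderiv ℝ (iteratedFDeriv ℝ k f) y (w 1)) x :=
    hd.clm_apply (differentiableAt_const _)
  rw [fderiv_continuousMultilinear_apply_const_apply hd2]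
  rw [fderiv_clm_apply hd (differentiableAt_const _)]
  simp

/-- Symmetry of iterated derivatives of a smooth function. -/
theorem jetAux_iteratedFDeriv_symm {X Y : Type*} [NormedAddCommGroup X] [NormedSpace ℝ X]
    [NormedAddCommGroup Y] [NormedSpace ℝ Y] {f : X → Y} (k : ℕ) :
    ∀ {x : X}, (∀ᶠ y in 𝓝 x, ContDiffAt ℝ ∞ f y) → ∀ (σ : Equiv.Perm (Fin k))
      (v : Fin k → X), iteratedFDeriv ℝ k f x (v ∘ σ) = iteratedFDeriv ℝ k f x v := by
  induction k with
  | zero =>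
    intro x _ σ v
    congr 1; exact Subsingleton.elim _ _
  | succ k ih =>
    intro x hf σ
    have hσ : σ ∈ Submonoid.closure
        (Set.range fun i : Fin k ↦ Equiv.swap i.castSucc i.succ) := by
      rw [Equiv.Perm.mclosure_swap_castSucc_succ]; trivial
    induction hσ using Submonoid.closure_induction with
    | one => intro v; rfl
    | mul a b _ _ ha hb =>
      intro v
      have : v ∘ (a * b : Equiv.Perm (Fin (k + 1))) = (v ∘ a) ∘ b := rfl
      rw [this, hb, ha]
    | mem s hs =>
      obtain ⟨i, rfl⟩ := hs
      intro v
      rcases k with _ | k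
      · exact i.elim0
      · induction i using Fin.cases with
        | zero =>
          have hx : ContDiffAt ℝ ∞ f x := hf.self_of_nhds
          have hg : ContDiffAt ℝ 2 (iteratedFDeriv ℝ k f) x :=
            hx.iteratedFDeriv_right (m := 2) (by
              rw [show ((2 : WithTop ℕ∞) + (k : WithTop ℕ∞)) = ((2 + k : ℕ) : WithTop ℕ∞) by
                push_cast; rfl]
              exact (WithTop.coe_le_coe.2 (le_top : ((2 + k : ℕ) : ℕ∞) ≤ ⊤)))
          have hs := hg.isSymmSndFDerivAt (by simp)
          rw [jetAux_iteratedFDeriv_succ_succ k hx, jetAux_iteratedFDeriv_succ_succ k hx,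
            ← hs.eq (v 1) (v 0)]
          have h0 : (v ∘ (Equiv.swap (Fin.castSucc 0) (Fin.succ 0) :
              Equiv.Perm (Fin (k + 2)))) 0 = v 1 := by simp
          have h1 : (v ∘ (Equiv.swap (Fin.castSucc 0) (Fin.succ 0) :
              Equiv.Perm (Fin (k + 2)))) 1 = v 0 := by simp
          rw [h0, h1]
          congr 1
        | succ j =>
          rw [iteratedFDeriv_succ_apply_left, iteratedFDeriv_succ_apply_left]
          have h0 : (v ∘ (Equiv.swap j.succ.castSucc j.succ.succ :
              Equiv.Perm (Fin (k + 2)))) 0 = v 0 := by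
            simp only [Function.comp_apply]
            congr 1
          have ht : Fin.tail (v ∘ (Equiv.swap j.succ.castSucc j.succ.succ :
              Equiv.Perm (Fin (k + 2)))) =
              Fin.tail v ∘ (Equiv.swap j.castSucc j.succ : Equiv.Perm (Fin (k + 1))) := by
            ext1 i
            simp only [Fin.tail, Function.comp_apply]
            congr 1
            simp only [Equiv.swap_apply_def, Fin.ext_iff, Fin.val_succ, Fin.val_castSucc]
            split_ifs <;> simp_all
          have hd : DifferentiableAt ℝ (iteratedFDeriv ℝ (k + 1) f) x :=
            (hf.self_of_nhds.iteratedFDeriv_right (m := 1) (i := k + 1)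
              (by exact_mod_cast le_top)).differentiableAt (by simp)
          rw [h0, ht, ← fderiv_continuousMultilinear_apply_const_apply hd,
            ← fderiv_continuousMultilinear_apply_const_apply hd]
          congr 1
          refine Filter.EventuallyEq.fderiv_eq ?_
          filter_upwards [hf.eventually_nhds] with y hy
          exact ih hy _ _

/-- Joint smoothness of iterated partial derivatives. -/
theorem jetAux_contDiffAt_iteratedFDeriv {P X Y : Type*} [NormedAddCommGroup P] [NormedSpace ℝ P]
    [NormedAddCommGroup X] [NormedSpace ℝ X] [NormedAddCommGroup Y] [NormedSpace ℝ Y]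
    {G : P → X → Y} {p : P} {x : X} (hG : ContDiffAt ℝ ∞ (Function.uncurry G) (p, x)) (k : ℕ) :
    ContDiffAt ℝ ∞ (Function.uncurry fun q y => iteratedFDeriv ℝ k (G q) y) (p, x) := by
  induction k with
  | zero =>
    have : (Function.uncurry fun q y => iteratedFDeriv ℝ 0 (G q) y) =
        (continuousMultilinearCurryFin0 ℝ X Y).symm ∘ Function.uncurry G := by
      ext1 z; simp [Function.uncurry, iteratedFDeriv_zero_eq_comp]
    rw [this]
    exact (continuousMultilinearCurryFin0 ℝ X Y).symm.contDiff.contDiffAt.comp (p, x) hG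
  | succ k ih =>
    have : (Function.uncurry fun q y => iteratedFDeriv ℝ (k + 1) (G q) y) =
        (continuousMultilinearCurryLeftEquiv ℝ (fun _ : Fin (k + 1) => X) Y).symm ∘
          fun z : P × X => fderiv ℝ (iteratedFDeriv ℝ k (G z.1)) z.2 := by
      ext1 z; simp [Function.uncurry, iteratedFDeriv_succ_eq_comp_left]
    rw [this]
    refine ContDiff.comp_contDiffAt (p, x) (LinearIsometryEquiv.contDiff
      (E := X →L[ℝ] X [×k]→L[ℝ] Y) (F := X [×k + 1]→L[ℝ] Y) _) ?_
    refine ContDiffAt.fderiv (f := fun (z : P × X) y => iteratedFDeriv ℝ k (G z.1) y)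
      (g := fun z : P × X => z.2) (n := ∞) ?_ contDiffAt_snd (by simp)
    have h2 : ContDiffAt ℝ ∞ (fun w : (P × X) × X => (w.1.1, w.2)) ((p, x), x) := by fun_prop
    exact ih.comp ((p, x), x) h2

/-- Two maps have the same derivatives up to order `r` at `x`. -/
def SameJet {X Y : Type*} [NormedAddCommGroup X] [NormedSpace ℝ X]
    [NormedAddCommGroup Y] [NormedSpace ℝ Y] (r : ℕ) (f g : X → Y) (x : X) : Prop :=
  ∀ k ≤ r, iteratedFDeriv ℝ k f x = iteratedFDeriv ℝ k g x

section SameJet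
variable {X Y Z : Type*} [NormedAddCommGroup X] [NormedSpace ℝ X]
  [NormedAddCommGroup Y] [NormedSpace ℝ Y] [NormedAddCommGroup Z] [NormedSpace ℝ Z] {r : ℕ}

theorem SameJet.apply_eq {f g : X → Y} {x : X} (h : SameJet r f g x) : f x = g x := by
  have := congrArg (fun A => A 0) (h 0 (Nat.zero_le _))
  simpa using this

theorem SameJet.of_eventuallyEq {f g : X → Y} {x : X} (h : f =ᶠ[𝓝 x] g) : SameJet r f g x :=
  fun k _ => (h.iteratedFDeriv ℝ k).self_of_nhds

theorem SameJet.symm {f g : X → Y} {x : X} (h : SameJet r f g x) : SameJet r g f x :=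
  fun k hk => (h k hk).symm

theorem SameJet.trans {f g h : X → Y} {x : X} (h1 : SameJet r f g x) (h2 : SameJet r g h x) :
    SameJet r f h x :=
  fun k hk => (h1 k hk).trans (h2 k hk)

theorem SameJet.comp {f₁ f₂ : X → Y} {g₁ g₂ : Y → Z} {x : X} (hf : SameJet r f₁ f₂ x)
    (hg : SameJet r g₁ g₂ (f₁ x)) (hf₁ : ContDiffAt ℝ ∞ f₁ x) (hf₂ : ContDiffAt ℝ ∞ f₂ x)
    (hg₁ : ContDiffAt ℝ ∞ g₁ (f₁ x)) (hg₂ : ContDiffAt ℝ ∞ g₂ (f₁ x)) :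
    SameJet r (g₁ ∘ f₁) (g₂ ∘ f₂) x := by
  intro k hk
  have h0 := hf.apply_eq
  have hg₂' := h0 ▸ hg₂
  rw [iteratedFDeriv_comp hg₁ hf₁ (by exact_mod_cast le_top),
    iteratedFDeriv_comp hg₂' hf₂ (by exact_mod_cast le_top)]
  simp only [FormalMultilinearSeries.taylorComp]
  refine Finset.sum_congr rfl fun c _ => ?_
  ext v
  simp only [FormalMultilinearSeries.compAlongOrderedFinpartition_apply, ftaylorSeries]
  rw [hg _ (c.length_le.trans hk), h0]
  congr 1
  ext1 i
  simp only [OrderedFinpartition.applyOrderedFinpartition_apply]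
  rw [hf _ ((c.partSize_le i).trans hk)]

end SameJet
end Analytic

section Model

/-- Euclidean space `ℝⁿ`. -/
abbrev Eu (n : ℕ) : Type := EuclideanSpace ℝ (Fin n)

/-- Symmetric `k`-linear maps `ℝⁿ × ⋯ × ℝⁿ → ℝᵐ`: the possible values of the `k`-th derivative of a
smooth map `ℝⁿ → ℝᵐ` at a point (with components `u^i_σ`, `|σ| = k`). -/
def symSubmodule (n m k : ℕ) : Submodule ℝ (Eu n [×k]→L[ℝ] Eu m) where
  carrier := {A | ∀ (σ : Equiv.Perm (Fin k)) (v : Fin k → Eu n), A (v ∘ σ) = A v}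
  add_mem' := fun {A B} hA hB σ v => by
    simp only [add_apply, hA σ v, hB σ v]
  zero_mem' := fun _ _ => rfl
  smul_mem' := fun c A hA σ v => by
    simp only [smul_apply, hA σ v]

/-- The normed space of symmetric `k`-linear maps `ℝⁿ × ⋯ × ℝⁿ → ℝᵐ`. -/
def SymTensor (n m k : ℕ) : Type := symSubmodule n m k

instance SymTensor.normedAddCommGroup (n m k : ℕ) : NormedAddCommGroup (SymTensor n m k) :=
  inferInstanceAs (NormedAddCommGroup (symSubmodule n m k))

instance SymTensor.normedSpace (n m k : ℕ) : NormedSpace ℝ (SymTensor n m k) :=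
  inferInstanceAs (NormedSpace ℝ (symSubmodule n m k))

/-- The underlying multilinear map. -/
def SymTensor.toMulti {n m k : ℕ} : SymTensor n m k →L[ℝ] (Eu n [×k]→L[ℝ] Eu m) :=
  (symSubmodule n m k).subtypeL

theorem SymTensor.toMulti_mem {n m k : ℕ} (A : SymTensor n m k) :
    A.toMulti ∈ symSubmodule n m k := A.2

theorem SymTensor.toMulti_injective {n m k : ℕ} {A B : SymTensor n m k}
    (h : A.toMulti = B.toMulti) : A = B := Subtype.ext h

/-- The coordinate space `(x^λ, u^i_σ)`, `0 ≤ |σ| ≤ r`, of `r`-jets of maps `ℝⁿ → ℝᵐ`. -/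
abbrev JetModel (n m r : ℕ) : Type := Eu n × ((k : Fin (r + 1)) → SymTensor n m k)

/-- Symmetrization of multilinear maps. -/
def symLin (n m k : ℕ) : (Eu n [×k]→L[ℝ] Eu m) →L[ℝ] (Eu n [×k]→L[ℝ] Eu m) :=
  (k.factorial : ℝ)⁻¹ • ∑ σ : Equiv.Perm (Fin k),
    ((ContinuousMultilinearMap.domDomCongrₗᵢ ℝ (Eu n) (Eu m) σ).toContinuousLinearEquiv :
      (Eu n [×k]→L[ℝ] Eu m) →L[ℝ] (Eu n [×k]→L[ℝ] Eu m))

theorem symLin_apply {n m k : ℕ} (A : Eu n [×k]→L[ℝ] Eu m) (v : Fin k → Eu n) :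
    symLin n m k A v = (k.factorial : ℝ)⁻¹ • ∑ σ : Equiv.Perm (Fin k), A (v ∘ σ) := by
  have h1 : symLin n m k A = (k.factorial : ℝ)⁻¹ • ∑ σ : Equiv.Perm (Fin k),
      A.domDomCongr σ := by
    rw [symLin, smul_apply, sum_apply]
    rfl
  rw [h1, smul_apply, sum_apply]
  rfl

/-- Symmetrization, as a projection onto the space of symmetric multilinear maps. -/
def symProj (n m k : ℕ) : (Eu n [×k]→L[ℝ] Eu m) →L[ℝ] SymTensor n m k :=
  (symLin n m k).codRestrict (symSubmodule n m k) (by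
    intro A τ v
    rw [symLin_apply, symLin_apply]
    congr 1
    exact Fintype.sum_equiv (Equiv.mulLeft τ) _ _ fun σ => rfl)

theorem symProj_of_mem {n m k : ℕ} {A : Eu n [×k]→L[ℝ] Eu m} (hA : A ∈ symSubmodule n m k) :
    (symProj n m k A).toMulti = A := by
  ext1 v
  have h : ∀ σ : Equiv.Perm (Fin k), A (v ∘ σ) = A v := fun σ => hA σ v
  change symLin n m k A v = A v
  rw [symLin_apply]
  simp only [h, Finset.sum_const, Finset.card_univ, Fintype.card_perm, Fintype.card_fin]
  rw [← Nat.cast_smul_eq_nsmul ℝ, smul_smul, inv_mul_cancel₀ (by positivity), one_smul]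

theorem contDiff_symProj (n m k : ℕ) : ContDiff ℝ ∞ (fun A => symProj n m k A) := by
  exact ContinuousLinearMap.contDiff (𝕜 := ℝ) (E := Eu n [×k]→L[ℝ] Eu m)
    (F := SymTensor n m k) (symProj n m k)

/-- The Taylor polynomial with prescribed derivatives `z.2 k` at the point `z.1`. -/
def jetPoly {n m r : ℕ} (z : JetModel n m r) (y : Eu n) : Eu m :=
  ∑ k : Fin (r + 1), ((k : ℕ).factorial : ℝ)⁻¹ •
    (z.2 k).toMulti (fun _ => y - z.1)

theorem contDiff_jetPoly {n m r : ℕ} :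
    ContDiff ℝ ∞ (fun w : JetModel n m r × Eu n => jetPoly w.1 w.2) := by
  unfold jetPoly
  refine ContDiff.sum fun k _ => ContDiff.const_smul _ ?_
  rw [contDiff_iff_contDiffAt]
  intro w
  have h := (ContinuousLinearMap.analyticAt_uncurry_of_multilinear (𝕜 := ℝ)
    (G := SymTensor n m k) (f := SymTensor.toMulti)
    (x := (w.1.2 k, fun _ => w.2 - w.1.1))).contDiffAt (n := ∞)
  refine h.comp (f := fun w : JetModel n m r × Eu n => (w.1.2 k, fun _ => w.2 - w.1.1)) w ?_
  refine ContDiffAt.prodMk ?_ (contDiffAt_pi.2 fun _ => by fun_prop)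
  exact contDiffAt_pi.1 (contDiff_snd.comp contDiff_fst).contDiffAt k

theorem contDiff_jetPoly_diag {n m r : ℕ} :
    ContDiff ℝ ∞ (fun z : JetModel n m r => (z.1, jetPoly z z.1)) :=
  contDiff_fst.prodMk (ContDiff.comp (contDiff_jetPoly (n := n) (m := m) (r := r))
    (f := fun z : JetModel n m r => (z, z.1)) (contDiff_id.prodMk contDiff_fst))

theorem contDiff_jetPoly_graph {n m r : ℕ} (z : JetModel n m r) :
    ContDiff ℝ ∞ (fun y : Eu n => (y, jetPoly z y)) :=
  contDiff_id.prodMk (ContDiff.comp (contDiff_jetPoly (n := n) (m := m) (r := r))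
    (f := fun y : Eu n => (z, y)) (contDiff_const.prodMk contDiff_id))

theorem iteratedFDeriv_jetPoly {n m r : ℕ} (z : JetModel n m r) (k : Fin (r + 1)) :
    iteratedFDeriv ℝ k (jetPoly z) z.1 = (z.2 k).toMulti := by
  let p : FormalMultilinearSeries ℝ (Eu n) (Eu m) := fun k =>
    if h : k < r + 1 then ((k : ℕ).factorial : ℝ)⁻¹ • (z.2 ⟨k, h⟩).toMulti else 0
  have hp : HasFiniteFPowerSeriesOnBall (jetPoly z) p z.1 (r + 1) ⊤ := by
    refine HasFiniteFPowerSeriesOnBall.mk' (fun j hj => ?_) (by simp) (fun y _ => ?_)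
    · exact dif_neg (not_lt.2 hj)
    · rw [Finset.sum_range]
      have hp' : ∀ i : Fin (r + 1), p i =
          ((i : ℕ).factorial : ℝ)⁻¹ • (z.2 i).toMulti :=
        fun i => dif_pos i.2
      simp [hp', jetPoly]
  have hA : AnalyticOn ℝ (jetPoly z) univ := by
    intro y _
    have := hp.toHasFPowerSeriesOnBall.analyticAt_of_mem (y := y) (by simp)
    exact this.analyticWithinAt
  ext1 v
  rw [hp.toHasFPowerSeriesOnBall.iteratedFDeriv_eq_sum hA]
  have hk : p k = ((k : ℕ).factorial : ℝ)⁻¹ • (z.2 k).toMulti :=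
    dif_pos k.2
  have h : ∀ σ : Equiv.Perm (Fin k),
      (z.2 k).toMulti (fun i => v (σ i)) =
        (z.2 k).toMulti v := fun σ => (z.2 k).toMulti_mem σ v
  simp only [hk, smul_apply, h, Finset.sum_const, Finset.card_univ,
    Fintype.card_perm, Fintype.card_fin]
  rw [← Nat.cast_smul_eq_nsmul ℝ, smul_smul, mul_inv_cancel₀ (by positivity), one_smul]

theorem jetPoly_self {n m r : ℕ} (z : JetModel n m r) :
    jetPoly z z.1 = (z.2 0).toMulti 0 := by
  have := congrArg (fun A => A 0) (iteratedFDeriv_jetPoly z 0)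
  rw [← this]
  rfl

end Model

/-- A fibred manifold `π : E → M`, `dim M = n`, `dim E = n + m`: a surjective smooth submersion. -/
structure FibredManifold (n m : ℕ) (M E : Type*) [TopologicalSpace M] [ChartedSpace (Eu n) M]
    [TopologicalSpace E] [ChartedSpace (Eu (n + m)) E] where
  proj : E → M
  surjective : Function.Surjective proj
  submersion : Manifold.IsSubmersionOfComplement (Eu m) (𝓡 (n + m)) (𝓡 n) ∞ proj

section Jets

variable {n m : ℕ} {M E : Type*} [TopologicalSpace M] [ChartedSpace (Eu n) M]
  [TopologicalSpace E] [ChartedSpace (Eu (n + m)) E]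

/-- `s` is a smooth section of `π` on a neighbourhood of `x`. -/
def IsSectionNear (π : FibredManifold n m M E) (s : M → E) (x : M) : Prop :=
  ∀ᶠ y in 𝓝 x, π.proj (s y) = y ∧ ContMDiffAt (𝓡 n) (𝓡 (n + m)) ∞ s y

/-- A local section of `π` around a base point. -/
structure LocalSection (π : FibredManifold n m M E) where
  base : M
  toFun : M → E
  isSection : IsSectionNear π toFun base

namespace LocalSection

variable {π : FibredManifold n m M E}

/-- The value of a local section at its base point. -/
def value (g : LocalSection π) : E := g.toFun g.base

/-- The coordinate representation of a local section (in the preferred charts). -/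
def chartRep (g : LocalSection π) : Eu n → Eu (n + m) :=
  writtenInExtChartAt (𝓡 n) (𝓡 (n + m)) g.base g.toFun

/-- The coordinates of the base point. -/
def chartPt (g : LocalSection π) : Eu n := extChartAt (𝓡 n) g.base g.base

theorem proj_value (g : LocalSection π) : π.proj g.value = g.base :=
  g.isSection.self_of_nhds.1

theorem contMDiffAt (g : LocalSection π) : ContMDiffAt (𝓡 n) (𝓡 (n + m)) ∞ g.toFun g.base :=
  g.isSection.self_of_nhds.2

end LocalSection

/-- Two local sections have the same `r`-jet: same base point, same value, and same partial
derivatives up to order `r` in coordinates. -/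
def jetSetoid (π : FibredManifold n m M E) (r : ℕ) : Setoid (LocalSection π) where
  r g g' := g.base = g'.base ∧ g.value = g'.value ∧ SameJet r g.chartRep g'.chartRep g.chartPt
  iseqv :=
    { refl := fun _ => ⟨rfl, rfl, fun _ _ => rfl⟩
      symm := by
        rintro g g' ⟨h1, h2, h3⟩
        refine ⟨h1.symm, h2.symm, ?_⟩
        have : g'.chartPt = g.chartPt := by simp only [LocalSection.chartPt, h1]
        rw [this]
        exact h3.symm
      trans := by
        rintro g g' g'' ⟨h1, h2, h3⟩ ⟨h1', h2', h3'⟩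
        refine ⟨h1.trans h1', h2.trans h2', h3.trans ?_⟩
        have : g'.chartPt = g.chartPt := by simp only [LocalSection.chartPt, h1]
        rwa [this] at h3' }

/-- The `r`-th jet space `J^r π`. -/
def JetSpace (π : FibredManifold n m M E) (r : ℕ) : Type _ := Quotient (jetSetoid π r)

/-- A chart of `E` adapted to the fibring, `p ↦ (x^λ, u^i)`. -/
structure AdaptedChart (π : FibredManifold n m M E) where
  total : OpenPartialHomeomorph E (Eu n × Eu m)
  base : OpenPartialHomeomorph M (Eu n)
  smooth_total : ContMDiffOn (𝓡 (n + m)) 𝓘(ℝ, Eu n × Eu m) ∞ total total.source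
  smooth_total_symm : ContMDiffOn 𝓘(ℝ, Eu n × Eu m) (𝓡 (n + m)) ∞ total.symm total.target
  smooth_base : ContMDiffOn (𝓡 n) 𝓘(ℝ, Eu n) ∞ base base.source
  smooth_base_symm : ContMDiffOn 𝓘(ℝ, Eu n) (𝓡 n) ∞ base.symm base.target
  proj_mem : ∀ p ∈ total.source, π.proj p ∈ base.source
  base_proj : ∀ p ∈ total.source, base (π.proj p) = (total p).1

section Charts
variable (π : FibredManifold n m M E)

/-- An adapted chart around a given point. -/
def adaptedChartAt (p : E) : AdaptedChart π where
  total := (π.submersion p).domChart.transHomeomorph (π.submersion p).equiv.toHomeomorph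
  base := (π.submersion p).codChart
  smooth_total := by
    have h := contMDiffOn_of_mem_maximalAtlas (π.submersion p).domChart_mem_maximalAtlas
    exact (π.submersion p).equiv.contDiff.contMDiff.comp_contMDiffOn h
  smooth_total_symm := by
    have h := contMDiffOn_symm_of_mem_maximalAtlas (π.submersion p).domChart_mem_maximalAtlas
    refine h.comp (π.submersion p).equiv.symm.contDiff.contMDiff.contMDiffOn ?_
    intro z hz
    exact hz
  smooth_base := contMDiffOn_of_mem_maximalAtlas (π.submersion p).codChart_mem_maximalAtlas
  smooth_base_symm :=
    contMDiffOn_symm_of_mem_maximalAtlas (π.submersion p).codChart_mem_maximalAtlas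
  proj_mem := fun q hq => (π.submersion p).source_subset_preimage_source hq
  base_proj := fun q hq => by
    have hq' : q ∈ (π.submersion p).domChart.source := hq
    have hm : (π.submersion p).domChart q ∈
        ((π.submersion p).domChart.extend (𝓡 (n + m))).target := by
      simpa using (π.submersion p).domChart.map_source hq'
    have h := (π.submersion p).writtenInCharts hm
    simpa [hq'] using h

theorem mem_adaptedChartAt_source (p : E) : p ∈ (adaptedChartAt π p).total.source :=
  (π.submersion p).mem_domChart_source

end Charts

end Jets

section JetCharts

variable {n m : ℕ} {M E : Type*} [TopologicalSpace M] [ChartedSpace (Eu n) M]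
  [TopologicalSpace E] [ChartedSpace (Eu (n + m)) E] {π : FibredManifold n m M E}

theorem SameJet.prodMk {X Y Z : Type*} [NormedAddCommGroup X] [NormedSpace ℝ X]
    [NormedAddCommGroup Y] [NormedSpace ℝ Y] [NormedAddCommGroup Z] [NormedSpace ℝ Z] {r : ℕ}
    {f₁ f₂ : X → Y} {g₁ g₂ : X → Z} {x : X} (hf : SameJet r f₁ f₂ x) (hg : SameJet r g₁ g₂ x)
    (hf₁ : ContDiffAt ℝ ∞ f₁ x) (hf₂ : ContDiffAt ℝ ∞ f₂ x)
    (hg₁ : ContDiffAt ℝ ∞ g₁ x) (hg₂ : ContDiffAt ℝ ∞ g₂ x) :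
    SameJet r (fun y => (f₁ y, g₁ y)) (fun y => (f₂ y, g₂ y)) x := by
  intro k hk
  have hk' : ((k : ℕ) : WithTop ℕ∞) ≤ ∞ := by exact_mod_cast le_top
  rw [iteratedFDeriv_prodMk hf₁ hg₁ hk', iteratedFDeriv_prodMk hf₂ hg₂ hk', hf k hk, hg k hk]

namespace AdaptedChart

variable (c : AdaptedChart π)

/-- The fibre coordinates of a local section as functions of the base coordinates. -/
def localRep (g : LocalSection π) : Eu n → Eu m :=
  fun y => (c.total (g.toFun (c.base.symm y))).2

theorem base_mem {g : LocalSection π} (hg : g.value ∈ c.total.source) :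
    g.base ∈ c.base.source := g.proj_value ▸ c.proj_mem _ hg

theorem base_symm_base {g : LocalSection π} (hg : g.value ∈ c.total.source) :
    c.base.symm (c.base g.base) = g.base := c.base.left_inv (c.base_mem hg)

theorem total_value {g : LocalSection π} (hg : g.value ∈ c.total.source) :
    c.total g.value = (c.base g.base, c.localRep g (c.base g.base)) := by
  refine Prod.ext ?_ ?_
  · rw [← c.base_proj _ hg, g.proj_value]
  · simp only [localRep, c.base_symm_base hg]; rfl

theorem tendsto_base_symm {g : LocalSection π} (hg : g.value ∈ c.total.source) :
    Tendsto c.base.symm (𝓝 (c.base g.base)) (𝓝 g.base) := by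
  have := c.base.continuousAt_symm (c.base.map_source (c.base_mem hg))
  rwa [ContinuousAt, c.base_symm_base hg] at this

theorem eventually_mem {g : LocalSection π} (hg : g.value ∈ c.total.source) :
    ∀ᶠ x in 𝓝 g.base, g.toFun x ∈ c.total.source :=
  g.contMDiffAt.continuousAt.eventually (c.total.open_source.mem_nhds hg)

theorem smooth_localRep {g : LocalSection π} (hg : g.value ∈ c.total.source) :
    ∀ᶠ y in 𝓝 (c.base g.base), ContDiffAt ℝ ∞ (c.localRep g) y := by
  have ht := c.tendsto_base_symm hg
  filter_upwards [ht.eventually g.isSection, ht.eventually (c.eventually_mem hg),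
    c.base.open_target.mem_nhds (c.base.map_source (c.base_mem hg))] with y h1 h2 h3
  rw [← contMDiffAt_iff_contDiffAt]
  have e1 : ContMDiffAt 𝓘(ℝ, Eu n) (𝓡 n) ∞ c.base.symm y :=
    c.smooth_base_symm.contMDiffAt (c.base.open_target.mem_nhds h3)
  have e2 := c.smooth_total.contMDiffAt (c.total.open_source.mem_nhds h2)
  have e3 : ContMDiffAt 𝓘(ℝ, Eu n) 𝓘(ℝ, Eu n × Eu m) ∞
      (fun y => c.total (g.toFun (c.base.symm y))) y :=
    ContMDiffAt.comp y (g := c.total) e2 (ContMDiffAt.comp y h1.2 e1)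
  exact (contDiff_snd.contMDiff.contMDiffAt).comp y e3

end AdaptedChart

section
variable [IsManifold (𝓡 n) ∞ M] [IsManifold (𝓡 (n + m)) ∞ E]

theorem LocalSection.contDiffAt_chartRep (g : LocalSection π) :
    ContDiffAt ℝ ∞ g.chartRep g.chartPt := by
  rw [← contMDiffAt_iff_contDiffAt]
  have h1 : ContMDiffAt 𝓘(ℝ, Eu n) (𝓡 n) ∞ (extChartAt (𝓡 n) g.base).symm g.chartPt :=
    (contMDiffOn_extChartAt_symm g.base).contMDiffAt (extChartAt_target_mem_nhds g.base)
  have h2 : (extChartAt (𝓡 n) g.base).symm g.chartPt = g.base := extChartAt_to_inv g.base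
  have h3 : ContMDiffAt (𝓡 n) (𝓡 (n + m)) ∞ g.toFun
    ((extChartAt (𝓡 n) g.base).symm g.chartPt) := by rw [h2]; exact g.contMDiffAt
  have h4 : ContMDiffAt (𝓡 (n + m)) 𝓘(ℝ, Eu (n + m)) ∞
      (extChartAt (𝓡 (n + m)) (g.toFun g.base))
      (g.toFun ((extChartAt (𝓡 n) g.base).symm g.chartPt)) := by
    rw [h2]; exact contMDiffAt_extChartAt
  exact ContMDiffAt.comp g.chartPt (g := extChartAt (𝓡 (n + m)) (g.toFun g.base)) h4
    (ContMDiffAt.comp g.chartPt h3 h1)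

namespace AdaptedChart
variable (c : AdaptedChart π)

/-- The transition from the preferred charts to an adapted chart: base coordinates. -/
theorem contDiffAt_base_trans {x : M} (hx : x ∈ c.base.source) :
    ContDiffAt ℝ ∞ (extChartAt (𝓡 n) x ∘ c.base.symm) (c.base x) := by
  rw [← contMDiffAt_iff_contDiffAt]
  have h1 : ContMDiffAt 𝓘(ℝ, Eu n) (𝓡 n) ∞ c.base.symm (c.base x) :=
    c.smooth_base_symm.contMDiffAt (c.base.open_target.mem_nhds (c.base.map_source hx))
  refine ContMDiffAt.comp _ ?_ h1
  rw [c.base.left_inv hx]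
  exact contMDiffAt_extChartAt

theorem contDiffAt_base_trans' {x : M} (hx : x ∈ c.base.source) :
    ContDiffAt ℝ ∞ (c.base ∘ (extChartAt (𝓡 n) x).symm) (extChartAt (𝓡 n) x x) := by
  rw [← contMDiffAt_iff_contDiffAt]
  have h1 : ContMDiffAt 𝓘(ℝ, Eu n) (𝓡 n) ∞ (extChartAt (𝓡 n) x).symm (extChartAt (𝓡 n) x x) :=
    (contMDiffOn_extChartAt_symm x).contMDiffAt (extChartAt_target_mem_nhds x)
  refine ContMDiffAt.comp _ ?_ h1
  rw [extChartAt_to_inv]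
  exact c.smooth_base.contMDiffAt (c.base.open_source.mem_nhds hx)

theorem contDiffAt_total_trans {p : E} (hp : p ∈ c.total.source) :
    ContDiffAt ℝ ∞ (c.total ∘ (extChartAt (𝓡 (n + m)) p).symm)
      (extChartAt (𝓡 (n + m)) p p) := by
  rw [← contMDiffAt_iff_contDiffAt]
  have h1 : ContMDiffAt 𝓘(ℝ, Eu (n + m)) (𝓡 (n + m)) ∞ (extChartAt (𝓡 (n + m)) p).symm
      (extChartAt (𝓡 (n + m)) p p) :=
    (contMDiffOn_extChartAt_symm p).contMDiffAt (extChartAt_target_mem_nhds p)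
  refine ContMDiffAt.comp _ ?_ h1
  rw [extChartAt_to_inv]
  exact c.smooth_total.contMDiffAt (c.total.open_source.mem_nhds hp)

theorem contDiffAt_total_trans' {p : E} (hp : p ∈ c.total.source) :
    ContDiffAt ℝ ∞ (extChartAt (𝓡 (n + m)) p ∘ c.total.symm) (c.total p) := by
  rw [← contMDiffAt_iff_contDiffAt]
  have h1 : ContMDiffAt 𝓘(ℝ, Eu n × Eu m) (𝓡 (n + m)) ∞ c.total.symm (c.total p) :=
    c.smooth_total_symm.contMDiffAt (c.total.open_target.mem_nhds (c.total.map_source hp))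
  refine ContMDiffAt.comp _ ?_ h1
  rw [c.total.left_inv hp]
  exact contMDiffAt_extChartAt

theorem localRep_eventuallyEq {g : LocalSection π} (hg : g.value ∈ c.total.source) :
    c.localRep g =ᶠ[𝓝 (c.base g.base)]
      (Prod.snd ∘ (c.total ∘ (extChartAt (𝓡 (n + m)) g.value).symm)) ∘
        (g.chartRep ∘ (extChartAt (𝓡 n) g.base ∘ c.base.symm)) := by
  have ht := c.tendsto_base_symm hg
  filter_upwards [ht.eventually (extChartAt_source_mem_nhds (I := 𝓡 n) g.base),
    ht.eventually (g.contMDiffAt.continuousAt.eventually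
      (extChartAt_source_mem_nhds (I := 𝓡 (n + m)) g.value))] with y h1 h2
  simp only [localRep, Function.comp_apply, LocalSection.chartRep, writtenInExtChartAt,
    (extChartAt (𝓡 n) g.base).left_inv h1]
  rw [show g.toFun g.base = g.value from rfl,
    (extChartAt (𝓡 (n + m)) g.value).left_inv h2]

/-- The derivatives of the coordinate expression in an adapted chart only depend on the jet. -/
theorem sameJet_localRep {r : ℕ} {g g' : LocalSection π} (h : jetSetoid π r g g')
    (hg : g.value ∈ c.total.source) :
    SameJet r (c.localRep g) (c.localRep g') (c.base g.base) := by
  obtain ⟨hb, hv, hj⟩ := h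
  have hg' : g'.value ∈ c.total.source := hv ▸ hg
  have e := SameJet.of_eventuallyEq (r := r) (c.localRep_eventuallyEq hg)
  have e' := SameJet.of_eventuallyEq (r := r) (c.localRep_eventuallyEq hg')
  rw [← hb, ← hv] at e'
  refine e.trans (SameJet.trans ?_ e'.symm)
  have hpt : (extChartAt (𝓡 n) g.base ∘ c.base.symm) (c.base g.base) = g.chartPt := by
    simp only [Function.comp_apply, c.base_symm_base hg]; rfl
  have hpt' : g'.chartPt = g.chartPt := by simp only [LocalSection.chartPt, hb]
  have hsm := c.contDiffAt_base_trans (c.base_mem hg)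
  have hr : ContDiffAt ℝ ∞ g.chartRep g.chartPt := g.contDiffAt_chartRep
  have hr' : ContDiffAt ℝ ∞ g'.chartRep g.chartPt := hpt' ▸ g'.contDiffAt_chartRep
  have hval : g.chartRep g.chartPt = extChartAt (𝓡 (n + m)) g.value g.value := by
    simp only [LocalSection.chartRep, LocalSection.chartPt, writtenInExtChartAt,
      Function.comp_apply, extChartAt_to_inv]; rfl
  have ht := c.contDiffAt_total_trans hg
  have key : SameJet r (g.chartRep ∘ (extChartAt (𝓡 n) g.base ∘ c.base.symm))
      (g'.chartRep ∘ (extChartAt (𝓡 n) g.base ∘ c.base.symm)) (c.base g.base) :=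
    SameJet.comp (fun _ _ => rfl) (hpt ▸ hj) hsm hsm (hpt ▸ hr) (hpt ▸ hr')
  have hT : ContDiffAt ℝ ∞ (Prod.snd ∘ (c.total ∘ (extChartAt (𝓡 (n + m)) g.value).symm))
      ((g.chartRep ∘ (extChartAt (𝓡 n) g.base ∘ c.base.symm)) (c.base g.base)) := by
    refine contDiffAt_snd.comp _ ?_
    rw [Function.comp_apply, hpt, hval]
    exact ht
  refine SameJet.comp key (fun _ _ => rfl) ?_ ?_ hT hT
  · exact ContDiffAt.comp _ (hpt ▸ hr) hsm
  · exact ContDiffAt.comp _ (hpt ▸ hr') hsm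

theorem chartRep_eventuallyEq {g : LocalSection π} (hg : g.value ∈ c.total.source) :
    g.chartRep =ᶠ[𝓝 g.chartPt]
      (extChartAt (𝓡 (n + m)) g.value ∘ c.total.symm) ∘
        ((fun y => (y, c.localRep g y)) ∘ (c.base ∘ (extChartAt (𝓡 n) g.base).symm)) := by
  have ht : Tendsto (extChartAt (𝓡 n) g.base).symm (𝓝 g.chartPt) (𝓝 g.base) := by
    have := continuousAt_extChartAt_symm (I := 𝓡 n) g.base
    rwa [ContinuousAt, extChartAt_to_inv] at this
  filter_upwards [ht.eventually (c.base.open_source.mem_nhds (c.base_mem hg)),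
    ht.eventually (c.eventually_mem hg), ht.eventually g.isSection] with y h1 h2 h3
  simp only [localRep, Function.comp_apply, LocalSection.chartRep, writtenInExtChartAt,
    c.base.left_inv h1]
  have h4 : (c.base ((extChartAt (𝓡 n) g.base).symm y),
      (c.total (g.toFun ((extChartAt (𝓡 n) g.base).symm y))).2) =
      c.total (g.toFun ((extChartAt (𝓡 n) g.base).symm y)) := by
    refine Prod.ext ?_ rfl
    rw [← c.base_proj _ h2, h3.1]
  rw [h4, c.total.left_inv h2]
  rfl

/-- Sections with the same derivatives in an adapted chart have the same jet. -/
theorem jetSetoid_of_sameJet {r : ℕ} {g g' : LocalSection π}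
    (hg : g.value ∈ c.total.source) (hg' : g'.value ∈ c.total.source)
    (hb : c.base g.base = c.base g'.base)
    (h : SameJet r (c.localRep g) (c.localRep g') (c.base g.base)) : jetSetoid π r g g' := by
  have hbase : g.base = g'.base := by
    rw [← c.base_symm_base hg, ← c.base_symm_base hg', hb]
  have hval : g.value = g'.value := by
    refine c.total.injOn hg hg' ?_
    rw [c.total_value hg, c.total_value hg', h.apply_eq, hb]
  refine ⟨hbase, hval, ?_⟩
  have hpt' : g'.chartPt = g.chartPt := by simp only [LocalSection.chartPt, hbase]
  have e := SameJet.of_eventuallyEq (r := r) (c.chartRep_eventuallyEq hg)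
  have e' := SameJet.of_eventuallyEq (r := r) (c.chartRep_eventuallyEq hg')
  rw [hpt', ← hbase, ← hval] at e'
  refine e.trans (SameJet.trans ?_ e'.symm)
  have hpt : (c.base ∘ (extChartAt (𝓡 n) g.base).symm) g.chartPt = c.base g.base := by
    simp only [Function.comp_apply, LocalSection.chartPt, extChartAt_to_inv]
  have hsm := c.contDiffAt_base_trans' (c.base_mem hg)
  have hl : ContDiffAt ℝ ∞ (c.localRep g) (c.base g.base) :=
    (c.smooth_localRep hg).self_of_nhds
  have hl' : ContDiffAt ℝ ∞ (c.localRep g') (c.base g.base) :=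
    hb ▸ (c.smooth_localRep hg').self_of_nhds
  have hp : ContDiffAt ℝ ∞ (fun y => (y, c.localRep g y)) (c.base g.base) :=
    contDiffAt_id.prodMk hl
  have hp' : ContDiffAt ℝ ∞ (fun y => (y, c.localRep g' y)) (c.base g.base) :=
    contDiffAt_id.prodMk hl'
  have h1 : SameJet r (fun y => (y, c.localRep g y)) (fun y => (y, c.localRep g' y))
      (c.base g.base) :=
    SameJet.prodMk (fun _ _ => rfl) h contDiffAt_id contDiffAt_id hl hl'
  have key : SameJet r
      ((fun y => (y, c.localRep g y)) ∘ (c.base ∘ (extChartAt (𝓡 n) g.base).symm))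
      ((fun y => (y, c.localRep g' y)) ∘ (c.base ∘ (extChartAt (𝓡 n) g.base).symm))
      g.chartPt :=
    SameJet.comp (fun _ _ => rfl) (hpt ▸ h1) hsm hsm (hpt ▸ hp) (hpt ▸ hp')
  have hT : ContDiffAt ℝ ∞ (extChartAt (𝓡 (n + m)) g.value ∘ c.total.symm)
      (((fun y => (y, c.localRep g y)) ∘ (c.base ∘ (extChartAt (𝓡 n) g.base).symm))
        g.chartPt) := by
    rw [Function.comp_apply, hpt, ← c.total_value hg]
    exact c.contDiffAt_total_trans' hg
  refine SameJet.comp key (fun _ _ => rfl) ?_ ?_ hT hT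
  · exact ContDiffAt.comp _ (hpt ▸ hp) hsm
  · exact ContDiffAt.comp _ (hpt ▸ hp') hsm

end AdaptedChart
end
end JetCharts

section JetManifold

variable {n m : ℕ} {M E : Type*} [TopologicalSpace M] [ChartedSpace (Eu n) M]
  [TopologicalSpace E] [ChartedSpace (Eu (n + m)) E] {π : FibredManifold n m M E}

/-- The projection `π^r_0 : J^r π → E`. -/
def JetSpace.toTotal {r : ℕ} (θ : JetSpace π r) : E :=
  Quotient.lift (s := jetSetoid π r) LocalSection.value (fun _ _ h => h.2.1) θ

/-- The projection `π^r : J^r π → M`. -/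
def JetSpace.toBase {r : ℕ} (θ : JetSpace π r) : M :=
  Quotient.lift (s := jetSetoid π r) LocalSection.base (fun _ _ h => h.1) θ

/-- The projection `π^{r+1}_r : J^{r+1} π → J^r π`. -/
def JetSpace.toLower {r : ℕ} (θ : JetSpace π (r + 1)) : JetSpace π r :=
  Quotient.map' (s₁ := jetSetoid π (r + 1)) (s₂ := jetSetoid π r) id
    (fun _ _ h => ⟨h.1, h.2.1, fun k hk => h.2.2 k (hk.trans (Nat.le_succ r))⟩) θ

/-- The `r`-jet of a local section at its base point. -/
def LocalSection.jet (r : ℕ) (g : LocalSection π) : JetSpace π r := Quotient.mk (jetSetoid π r) g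

/-- A local section representing a jet. -/
def JetSpace.rep {r : ℕ} (θ : JetSpace π r) : LocalSection π :=
  Quotient.out (s := jetSetoid π r) θ

theorem JetSpace.jet_rep {r : ℕ} (θ : JetSpace π r) : θ.rep.jet r = θ :=
  Quotient.out_eq (s := jetSetoid π r) θ

theorem JetSpace.rep_jet {r : ℕ} (g : LocalSection π) :
    jetSetoid π r (g.jet r).rep g := Quotient.mk_out (s := jetSetoid π r) g

theorem JetSpace.value_rep {r : ℕ} (θ : JetSpace π r) : θ.rep.value = θ.toTotal := by
  conv_rhs => rw [← θ.jet_rep]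
  rfl

namespace AdaptedChart

variable (c : AdaptedChart π) (r : ℕ)

/-- The coordinates `(x^λ, u^i_σ)` of a jet. -/
def jetCoord (θ : JetSpace π r) : JetModel n m r :=
  (c.base θ.rep.base,
    fun k : Fin (r + 1) => symProj n m k (iteratedFDeriv ℝ k (c.localRep θ.rep) (c.base θ.rep.base)))

/-- The image of a jet coordinate chart. -/
def jetTarget : Set (JetModel n m r) := {z | (z.1, jetPoly z z.1) ∈ c.total.target}

theorem continuous_jetTarget_map :
    Continuous (fun z : JetModel n m r => (z.1, jetPoly z z.1)) :=
  contDiff_jetPoly_diag.continuous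

theorem isOpen_jetTarget : IsOpen (c.jetTarget r) :=
  c.total.open_target.preimage (continuous_jetTarget_map r)

variable {r}

theorem fst_mem_target {z : Eu n × Eu m} (hz : z ∈ c.total.target) :
    z.1 ∈ c.base.target ∧ c.base (π.proj (c.total.symm z)) = z.1 := by
  have h1 := c.total.map_target hz
  have h2 := c.base_proj _ h1
  rw [c.total.right_inv hz] at h2
  exact ⟨h2 ▸ c.base.map_source (c.proj_mem _ h1), h2⟩

/-- The local section whose coordinate expression is the Taylor polynomial. -/
def polySection (z : JetModel n m r) (hz : z ∈ c.jetTarget r) : LocalSection π where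
  base := c.base.symm z.1
  toFun := fun x => c.total.symm (c.base x, jetPoly z (c.base x))
  isSection := by
    have hz1 : z.1 ∈ c.base.target := (c.fst_mem_target hz).1
    have hs : c.base.symm z.1 ∈ c.base.source := c.base.map_target hz1
    have hcont : Continuous (fun y : Eu n => (y, jetPoly z y)) :=
      (contDiff_jetPoly_graph z).continuous
    have ht : Tendsto c.base (𝓝 (c.base.symm z.1)) (𝓝 z.1) := by
      have := c.base.continuousAt hs
      rwa [ContinuousAt, c.base.right_inv hz1] at this
    have h1 : ∀ᶠ y in 𝓝 z.1, (y, jetPoly z y) ∈ c.total.target :=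
      hcont.continuousAt.eventually (c.total.open_target.mem_nhds hz)
    filter_upwards [ht.eventually h1, c.base.open_source.mem_nhds hs] with x hx hxs
    obtain ⟨h2, h3⟩ := c.fst_mem_target hx
    refine ⟨c.base.injOn (c.proj_mem _ (c.total.map_target hx)) hxs h3, ?_⟩
    have e1 : ContMDiffAt (𝓡 n) 𝓘(ℝ, Eu n) ∞ c.base x :=
      c.smooth_base.contMDiffAt (c.base.open_source.mem_nhds hxs)
    have e2 := (contDiff_jetPoly_graph z).contMDiff.contMDiffAt.comp x e1
    have e3 := c.smooth_total_symm.contMDiffAt (c.total.open_target.mem_nhds hx)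
    exact ContMDiffAt.comp x (g := c.total.symm) e3 e2

theorem base_polySection (z : JetModel n m r) (hz : z ∈ c.jetTarget r) :
    c.base (c.polySection z hz).base = z.1 := c.base.right_inv (c.fst_mem_target hz).1

theorem value_polySection (z : JetModel n m r) (hz : z ∈ c.jetTarget r) :
    (c.polySection z hz).value = c.total.symm (z.1, jetPoly z z.1) := by
  have h := c.base_polySection z hz
  change c.total.symm (c.base (c.polySection z hz).base,
    jetPoly z (c.base (c.polySection z hz).base)) = _
  rw [h]

theorem value_polySection_mem (z : JetModel n m r) (hz : z ∈ c.jetTarget r) :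
    (c.polySection z hz).value ∈ c.total.source := by
  rw [c.value_polySection]; exact c.total.map_target hz

theorem localRep_polySection (z : JetModel n m r) (hz : z ∈ c.jetTarget r) :
    c.localRep (c.polySection z hz) =ᶠ[𝓝 z.1] jetPoly z := by
  have hcont : Continuous (fun y : Eu n => (y, jetPoly z y)) :=
    (contDiff_jetPoly_graph z).continuous
  have h1 : ∀ᶠ y in 𝓝 z.1, (y, jetPoly z y) ∈ c.total.target :=
    hcont.continuousAt.eventually (c.total.open_target.mem_nhds hz)
  filter_upwards [h1, c.base.open_target.mem_nhds (c.fst_mem_target hz).1] with y hy hyt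
  simp only [localRep, polySection, c.base.right_inv hyt, c.total.right_inv hy]

end AdaptedChart

section
variable [IsManifold (𝓡 n) ∞ M] [IsManifold (𝓡 (n + m)) ∞ E]

namespace AdaptedChart
variable (c : AdaptedChart π) {r : ℕ}

/-- The coordinates of the jet of a section are its derivatives. -/
theorem jetCoord_jet {g : LocalSection π} (hg : g.value ∈ c.total.source) :
    c.jetCoord r (g.jet r) = (c.base g.base,
      fun k : Fin (r + 1) => symProj n m k (iteratedFDeriv ℝ k (c.localRep g) (c.base g.base))) := by
  have h : jetSetoid π r (g.jet r).rep g := JetSpace.rep_jet g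
  have hv : (g.jet r).rep.value ∈ c.total.source := h.2.1 ▸ hg
  have hj := c.sameJet_localRep h hv
  refine Prod.ext (congrArg c.base h.1) ?_
  funext k
  simp only [jetCoord]
  rw [hj k (Nat.lt_succ_iff.1 k.2), h.1]

theorem iteratedFDeriv_localRep_mem {g : LocalSection π} (hg : g.value ∈ c.total.source) (k : ℕ) :
    iteratedFDeriv ℝ k (c.localRep g) (c.base g.base) ∈ symSubmodule n m k :=
  fun σ v => jetAux_iteratedFDeriv_symm k (c.smooth_localRep hg) σ v

theorem sameJet_jetPoly (θ : JetSpace π r) (hθ : θ.toTotal ∈ c.total.source) :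
    SameJet r (c.localRep θ.rep) (jetPoly (c.jetCoord r θ)) (c.base θ.rep.base) := by
  intro k hk
  have h := iteratedFDeriv_jetPoly (c.jetCoord r θ) ⟨k, Nat.lt_succ_iff.2 hk⟩
  refine Eq.trans ?_ h.symm
  exact (symProj_of_mem (c.iteratedFDeriv_localRep_mem (θ.value_rep ▸ hθ) k)).symm

theorem jetCoord_mem_target (θ : JetSpace π r) (hθ : θ.toTotal ∈ c.total.source) :
    c.jetCoord r θ ∈ c.jetTarget r ∧
      ((c.jetCoord r θ).1, jetPoly (c.jetCoord r θ) (c.jetCoord r θ).1) = c.total θ.toTotal := by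
  have h1 := (c.sameJet_jetPoly θ hθ).apply_eq
  have h2 := c.total_value (g := θ.rep) (θ.value_rep ▸ hθ)
  rw [h1, θ.value_rep] at h2
  refine ⟨?_, h2.symm⟩
  change (_, _) ∈ c.total.target
  exact h2 ▸ c.total.map_source hθ

theorem jet_polySection_jetCoord (θ : JetSpace π r) (hθ : θ.toTotal ∈ c.total.source) :
    (c.polySection (c.jetCoord r θ) (c.jetCoord_mem_target θ hθ).1).jet r = θ := by
  have hz := (c.jetCoord_mem_target θ hθ).1
  conv_rhs => rw [← θ.jet_rep]
  refine Quotient.sound (s := jetSetoid π r) ?_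
  refine c.jetSetoid_of_sameJet (c.value_polySection_mem _ hz) (θ.value_rep ▸ hθ)
    (c.base_polySection _ hz) ?_
  rw [c.base_polySection]
  exact (SameJet.of_eventuallyEq (c.localRep_polySection _ hz)).trans
    (c.sameJet_jetPoly θ hθ).symm

theorem jetCoord_polySection (z : JetModel n m r) (hz : z ∈ c.jetTarget r) :
    c.jetCoord r ((c.polySection z hz).jet r) = z := by
  rw [c.jetCoord_jet (c.value_polySection_mem z hz)]
  refine Prod.ext (c.base_polySection z hz) ?_
  funext k
  refine SymTensor.toMulti_injective ?_
  rw [c.base_polySection z hz]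
  have h := SameJet.of_eventuallyEq (r := r) (c.localRep_polySection z hz) k
    (Nat.lt_succ_iff.1 k.2)
  change (symProj n m k (iteratedFDeriv ℝ k (c.localRep (c.polySection z hz)) z.1)).toMulti = _
  rw [h, iteratedFDeriv_jetPoly, symProj_of_mem (z.2 k).toMulti_mem]

end AdaptedChart

theorem JetSpace.nonempty_of_point (π : FibredManifold n m M E) (r : ℕ) (p : E) :
    Nonempty (JetSpace π r) := by
  let c := adaptedChartAt π p
  have hp : p ∈ c.total.source := mem_adaptedChartAt_source π p
  let A : Eu n [×0]→L[ℝ] Eu m := ContinuousMultilinearMap.constOfIsEmpty ℝ _ (c.total p).2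
  have hA : A ∈ symSubmodule n m 0 := fun _ _ => rfl
  let z : JetModel n m 0 := ((c.total p).1, fun k => by
    have hk : k = 0 := Fin.ext (by omega)
    exact hk ▸ (⟨A, hA⟩ : SymTensor n m ((0 : Fin 1) : ℕ)))
  have hz : z ∈ c.jetTarget 0 := by
    have : (z.1, jetPoly z z.1) = c.total p := by
      rw [jetPoly_self]; rfl
    change (z.1, jetPoly z z.1) ∈ c.total.target
    rw [this]; exact c.total.map_source hp
  exact ⟨(c.polySection z hz).jet r⟩

namespace AdaptedChart
variable (c : AdaptedChart π) (r : ℕ)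

open Classical in
/-- The chart of `J^r π` induced by an adapted chart of `E`. -/
def jetChart : PartialEquiv (JetSpace π r) (JetModel n m r) where
  toFun := c.jetCoord r
  invFun := fun z => if hz : z ∈ c.jetTarget r then (c.polySection z hz).jet r else
    (JetSpace.nonempty_of_point π r (c.total.symm (z.1, 0))).some
  source := {θ | θ.toTotal ∈ c.total.source}
  target := c.jetTarget r
  map_source' := fun θ hθ => (c.jetCoord_mem_target θ hθ).1
  map_target' := fun z hz => by
    simp only [dif_pos hz]
    exact c.value_polySection_mem z hz
  left_inv' := fun θ hθ => by
    rw [dif_pos (c.jetCoord_mem_target θ hθ).1]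
    exact c.jet_polySection_jetCoord θ hθ
  right_inv' := fun z hz => by
    rw [dif_pos hz]
    exact c.jetCoord_polySection z hz

theorem jetChart_symm_apply {r : ℕ} {z : JetModel n m r} (hz : z ∈ c.jetTarget r) :
    (c.jetChart r).symm z = (c.polySection z hz).jet r := dif_pos hz

theorem jetTrans_source (c' : AdaptedChart π) : ((c.jetChart r).symm.trans (c'.jetChart r)).source =
    (fun z : JetModel n m r => (z.1, jetPoly z z.1)) ⁻¹' (c.total.symm.trans c'.total).source := by
  ext z
  simp only [PartialEquiv.trans_source, PartialEquiv.symm_source, mem_inter_iff, mem_preimage,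
    OpenPartialHomeomorph.trans_source, OpenPartialHomeomorph.symm_source]
  refine and_congr_right fun hz => ?_
  have hz : z ∈ c.jetTarget r := hz
  rw [c.jetChart_symm_apply hz]
  change (c.polySection z hz).value ∈ c'.total.source ↔ _
  rw [c.value_polySection]

theorem isOpen_jetTrans_source (c' : AdaptedChart π) :
    IsOpen ((c.jetChart r).symm.trans (c'.jetChart r)).source := by
  rw [jetTrans_source]
  exact (c.total.symm.trans c'.total).open_source.preimage (continuous_jetTarget_map r)

/-- Smoothness of the changes of jet coordinates. -/
theorem contDiffOn_jetTrans (c' : AdaptedChart π) :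
    ContDiffOn ℝ ∞ ((c.jetChart r).symm.trans (c'.jetChart r))
      ((c.jetChart r).symm.trans (c'.jetChart r)).source := by
  have hopen := c.isOpen_jetTrans_source r c'
  intro z₀ hz₀
  refine ContDiffAt.contDiffWithinAt ?_
  let f : Eu n → Eu n := c'.base ∘ c.base.symm
  let ψ : Eu n → Eu n := c.base ∘ c'.base.symm
  let τ : Eu n × Eu m → Eu n × Eu m := c'.total ∘ c.total.symm
  let G : JetModel n m r → Eu n → Eu m := fun z y => (τ (ψ y, jetPoly z (ψ y))).2
  have hsrc : ∀ z ∈ ((c.jetChart r).symm.trans (c'.jetChart r)).source,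
      (z.1, jetPoly z z.1) ∈ (c.total.symm.trans c'.total).source := by
    intro z hz; rw [jetTrans_source] at hz; exact hz
  have hbase : ∀ z ∈ ((c.jetChart r).symm.trans (c'.jetChart r)).source,
      z.1 ∈ c.base.target ∧ c.base.symm z.1 ∈ c'.base.source := by
    intro z hz
    have h := hsrc z hz
    rw [OpenPartialHomeomorph.trans_source] at h
    obtain ⟨h1, h2⟩ := c.fst_mem_target h.1
    refine ⟨h1, ?_⟩
    have h3 := c'.proj_mem _ h.2
    have h4 : c.base.symm z.1 = π.proj (c.total.symm (z.1, jetPoly z z.1)) := by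
      rw [← c.base.left_inv (c.proj_mem _ (c.total.map_target h.1)), h2]
    exact h4 ▸ h3
  have hcoord : ∀ z ∈ ((c.jetChart r).symm.trans (c'.jetChart r)).source,
      ((c.jetChart r).symm.trans (c'.jetChart r)) z =
        (f z.1, fun k : Fin (r + 1) => symProj n m k (iteratedFDeriv ℝ k (G z) (f z.1))) := by
    intro z hz
    have hz1 : z ∈ c.jetTarget r := hz.1
    have hz2 : (c.jetChart r).symm z ∈ (c'.jetChart r).source := hz.2
    rw [c.jetChart_symm_apply hz1] at hz2
    rw [PartialEquiv.coe_trans, Function.comp_apply, c.jetChart_symm_apply hz1]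
    exact c'.jetCoord_jet hz2
  have hτ : ∀ w ∈ (c.total.symm.trans c'.total).source, ContDiffAt ℝ ∞ τ w := by
    intro w hw
    rw [OpenPartialHomeomorph.trans_source] at hw
    rw [← contMDiffAt_iff_contDiffAt]
    exact ContMDiffAt.comp w (g := c'.total)
      (c'.smooth_total.contMDiffAt (c'.total.open_source.mem_nhds hw.2))
      (c.smooth_total_symm.contMDiffAt (c.total.open_target.mem_nhds hw.1))
  obtain ⟨hb1, hb2⟩ := hbase z₀ hz₀
  have hf : ContDiffAt ℝ ∞ f z₀.1 := by
    rw [← contMDiffAt_iff_contDiffAt]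
    exact ContMDiffAt.comp z₀.1 (g := c'.base)
      (c'.smooth_base.contMDiffAt (c'.base.open_source.mem_nhds hb2))
      (c.smooth_base_symm.contMDiffAt (c.base.open_target.mem_nhds hb1))
  have hf1 : c'.base.symm (f z₀.1) = c.base.symm z₀.1 := c'.base.left_inv hb2
  have hψf : ψ (f z₀.1) = z₀.1 := by
    change c.base (c'.base.symm (f z₀.1)) = z₀.1
    rw [hf1, c.base.right_inv hb1]
  have hψ : ContDiffAt ℝ ∞ ψ (f z₀.1) := by
    rw [← contMDiffAt_iff_contDiffAt]
    refine ContMDiffAt.comp (f z₀.1) (g := c.base) ?_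
      (c'.smooth_base_symm.contMDiffAt (c'.base.open_target.mem_nhds (c'.base.map_source hb2)))
    rw [hf1]
    exact c.smooth_base.contMDiffAt (c.base.open_source.mem_nhds (c.base.map_target hb1))
  have hG : ContDiffAt ℝ ∞ (Function.uncurry G) (z₀, f z₀.1) := by
    have h1 : ContDiffAt ℝ ∞ (fun w : JetModel n m r × Eu n => ψ w.2) (z₀, f z₀.1) :=
      ContDiffAt.comp (z₀, f z₀.1) (g := ψ) hψ contDiffAt_snd
    have h2 : ContDiffAt ℝ ∞ (fun w : JetModel n m r × Eu n => jetPoly w.1 (ψ w.2))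
        (z₀, f z₀.1) :=
      ContDiffAt.comp (z₀, f z₀.1) (f := fun w : JetModel n m r × Eu n => (w.1, ψ w.2))
        contDiff_jetPoly.contDiffAt (contDiffAt_fst.prodMk h1)
    have h3 : ContDiffAt ℝ ∞ τ (ψ (f z₀.1), jetPoly z₀ (ψ (f z₀.1))) := by
      rw [hψf]; exact hτ _ (hsrc z₀ hz₀)
    exact contDiffAt_snd.comp (z₀, f z₀.1) (ContDiffAt.comp (z₀, f z₀.1)
      (f := fun w : JetModel n m r × Eu n => (ψ w.2, jetPoly w.1 (ψ w.2))) h3 (h1.prodMk h2))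
  have hfz : ContDiffAt ℝ ∞ (fun z : JetModel n m r => f z.1) z₀ :=
    ContDiffAt.comp z₀ (g := f) hf contDiffAt_fst
  have key : ContDiffAt ℝ ∞ (fun z : JetModel n m r =>
      ((f z.1, fun k : Fin (r + 1) => symProj n m k (iteratedFDeriv ℝ k (G z) (f z.1))) :
        JetModel n m r)) z₀ := by
    refine hfz.prodMk (contDiffAt_pi.2 fun k => ?_)
    have h1 := jetAux_contDiffAt_iteratedFDeriv hG k
    have h2 : ContDiffAt ℝ ∞ (fun z : JetModel n m r => iteratedFDeriv ℝ k (G z) (f z.1)) z₀ :=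
      ContDiffAt.comp z₀ (f := fun z : JetModel n m r => (z, f z.1)) h1
        (contDiffAt_id.prodMk hfz)
    exact (contDiff_symProj n m k).contDiffAt.comp z₀ h2
  refine key.congr_of_eventuallyEq ?_
  filter_upwards [hopen.mem_nhds hz₀] with z hz using hcoord z hz

end AdaptedChart

/-- The smooth atlas of `J^r π` made of the charts `(x^λ, u^i_σ)`. -/
def jetCore (π : FibredManifold n m M E) (r : ℕ) :
    ChartedSpaceCore (JetModel n m r) (JetSpace π r) where
  atlas := Set.range fun c : AdaptedChart π => c.jetChart r
  chartAt := fun θ => (adaptedChartAt π θ.toTotal).jetChart r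
  mem_chart_source := fun θ => mem_adaptedChartAt_source π θ.toTotal
  chart_mem_atlas := fun _ => ⟨_, rfl⟩
  open_source := by
    rintro _ _ ⟨c, rfl⟩ ⟨c', rfl⟩
    exact c.isOpen_jetTrans_source r c'
  continuousOn_toFun := by
    rintro _ _ ⟨c, rfl⟩ ⟨c', rfl⟩
    exact (c.contDiffOn_jetTrans r c').continuousOn

instance JetSpace.topologicalSpace (π : FibredManifold n m M E) (r : ℕ) :
    TopologicalSpace (JetSpace π r) :=
  (jetCore π r).toTopologicalSpace

instance JetSpace.chartedSpace (π : FibredManifold n m M E) (r : ℕ) :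
    ChartedSpace (JetModel n m r) (JetSpace π r) :=
  (jetCore π r).toChartedSpace

instance JetSpace.isManifold (π : FibredManifold n m M E) (r : ℕ) :
    IsManifold 𝓘(ℝ, JetModel n m r) ∞ (JetSpace π r) := by
  refine isManifold_of_contDiffOn _ _ _ ?_
  intro e e' he he'
  simp only [atlas, ChartedSpace.atlas, mem_iUnion, mem_singleton_iff] at he he'
  obtain ⟨_, ⟨c, rfl⟩, rfl⟩ := he
  obtain ⟨_, ⟨c', rfl⟩, rfl⟩ := he'
  have h := c.contDiffOn_jetTrans r c'
  simp only [modelWithCornersSelf_coe, modelWithCornersSelf_coe_symm, Function.id_comp,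
    Function.comp_id, preimage_id, range_id, inter_univ]
  exact h

end
end JetManifold

section Exterior

variable {V : Type*} [AddCommGroup V] [Module ℝ V] [TopologicalSpace V]

/-- The exterior product `β₁ ∧ ⋯ ∧ β_k` of `1`-forms,
`(v₁, …, v_k) ↦ ∑_σ sgn σ ∏_i β_i(v_{σ i}) = det (β_i(v_j))`. -/
def wedgeOneForms {k : ℕ} (β : Fin k → V →L[ℝ] ℝ) : V [⋀^Fin k]→L[ℝ] ℝ :=
  ContinuousMultilinearMap.alternatization
    ((ContinuousMultilinearMap.mkPiAlgebra ℝ (Fin k) ℝ).compContinuousLinearMap β)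

/-- The `k`-th exterior power `∧^k W` of a subspace `W ⊆ V*`, as a subspace of `∧^k V*`. -/
def extPower (k : ℕ) (W : Submodule ℝ (V →L[ℝ] ℝ)) : Submodule ℝ (V [⋀^Fin k]→L[ℝ] ℝ) :=
  Submodule.span ℝ {γ | ∃ β : Fin k → V →L[ℝ] ℝ, (∀ i, β i ∈ W) ∧ γ = wedgeOneForms β}

/-- The tensor product of two multilinear forms. -/
def tensorForms {p q : ℕ} (a : V [⋀^Fin p]→L[ℝ] ℝ) (b : V [⋀^Fin q]→L[ℝ] ℝ) :
    V [×(p + q)]→L[ℝ] ℝ where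
  toFun v := a (fun i => v (Fin.castAdd q i)) * b (fun j => v (Fin.natAdd p j))
  map_update_add' := by
    intro dec v i x y
    have hdec : dec = instDecidableEqFin (p + q) := Subsingleton.elim _ _
    subst hdec
    refine Fin.addCases (fun i => ?_) (fun j => ?_) i
    · have h1 : ∀ x : V, (fun i' => Function.update v (Fin.castAdd q i) x (Fin.castAdd q i')) =
          Function.update (fun i' => v (Fin.castAdd q i')) i x := fun x =>
        Function.update_comp_eq_of_injective v (Fin.castAdd_injective p q) i x
      have h2 : ∀ x : V, (fun j => Function.update v (Fin.castAdd q i) x (Fin.natAdd p j)) =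
          fun j => v (Fin.natAdd p j) := fun x => by
        ext1 j
        rw [Function.update_of_ne]
        simp [Fin.ext_iff]; omega
      simp only [h1, h2, a.map_update_add, add_mul]
    · have h1 : ∀ x : V, (fun i' => Function.update v (Fin.natAdd p j) x (Fin.natAdd p i')) =
          Function.update (fun i' => v (Fin.natAdd p i')) j x := fun x =>
        Function.update_comp_eq_of_injective v (Fin.natAdd_injective q p) j x
      have h2 : ∀ x : V, (fun i => Function.update v (Fin.natAdd p j) x (Fin.castAdd q i)) =
          fun i => v (Fin.castAdd q i) := fun x => by
        ext1 i
        rw [Function.update_of_ne]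
        simp [Fin.ext_iff]; omega
      simp only [h1, h2, b.map_update_add, mul_add]
  map_update_smul' := by
    intro dec v i c x
    have hdec : dec = instDecidableEqFin (p + q) := Subsingleton.elim _ _
    subst hdec
    refine Fin.addCases (fun i => ?_) (fun j => ?_) i
    · have h1 : ∀ x : V, (fun i' => Function.update v (Fin.castAdd q i) x (Fin.castAdd q i')) =
          Function.update (fun i' => v (Fin.castAdd q i')) i x := fun x =>
        Function.update_comp_eq_of_injective v (Fin.castAdd_injective p q) i x
      have h2 : ∀ x : V, (fun j => Function.update v (Fin.castAdd q i) x (Fin.natAdd p j)) =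
          fun j => v (Fin.natAdd p j) := fun x => by
        ext1 j
        rw [Function.update_of_ne]
        simp [Fin.ext_iff]; omega
      simp only [h1, h2, a.map_update_smul, smul_eq_mul, mul_assoc]
    · have h1 : ∀ x : V, (fun i' => Function.update v (Fin.natAdd p j) x (Fin.natAdd p i')) =
          Function.update (fun i' => v (Fin.natAdd p i')) j x := fun x =>
        Function.update_comp_eq_of_injective v (Fin.natAdd_injective q p) j x
      have h2 : ∀ x : V, (fun i => Function.update v (Fin.natAdd p j) x (Fin.castAdd q i)) =
          fun i => v (Fin.castAdd q i) := fun x => by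
        ext1 i
        rw [Function.update_of_ne]
        simp [Fin.ext_iff]; omega
      simp only [h1, h2, b.map_update_smul, smul_eq_mul]
      ring
  cont := by
    refine Continuous.mul (a.cont.comp ?_) (b.cont.comp ?_)
    · exact continuous_pi fun i => continuous_apply _
    · exact continuous_pi fun i => continuous_apply _

/-- The wedge product of alternating forms, `a ∧ b = (1 / (p! q!)) Alt(a ⊗ b)`. -/
def wedge {p q : ℕ} (a : V [⋀^Fin p]→L[ℝ] ℝ) (b : V [⋀^Fin q]→L[ℝ] ℝ) :
    V [⋀^Fin (p + q)]→L[ℝ] ℝ :=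
  ((p.factorial : ℝ) * (q.factorial : ℝ))⁻¹ •
    ContinuousMultilinearMap.alternatization (tensorForms a b)

/-- The subspace `∧^p U ∧ ∧^q W` of `∧^k V*`, `p + q = k`, generated by the wedge products of
elements of `∧^p U` and `∧^q W`. -/
def wedgePowers (p q k : ℕ) (h : p + q = k) (U W : Submodule ℝ (V →L[ℝ] ℝ)) :
    Submodule ℝ (V [⋀^Fin k]→L[ℝ] ℝ) :=
  Submodule.span ℝ {γ | ∃ a ∈ extPower p U, ∃ b ∈ extPower q W,
    γ = h ▸ wedge a b}

/-- The inclusion `⊙^k L(V, V) ⊂ L(∧^k V*, ∧^k V*)`: the symmetric product `A₁ ⊙ ⋯ ⊙ A_k` acts on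
alternating forms by `α ↦ ((v₁, …, v_k) ↦ (1 / k!) ∑_σ α(A_{σ 1} v₁, …, A_{σ k} v_k))`. -/
def symProdEnd {k : ℕ} (A : Fin k → V →L[ℝ] V) (α : V [⋀^Fin k]→L[ℝ] ℝ) :
    V [⋀^Fin k]→L[ℝ] ℝ :=
  (k.factorial : ℝ)⁻¹ • ContinuousMultilinearMap.alternatization
    (α.toContinuousMultilinearMap.compContinuousLinearMap A)

theorem symProdEnd_apply {k : ℕ} (A : Fin k → V →L[ℝ] V) (α : V [⋀^Fin k]→L[ℝ] ℝ)
    (v : Fin k → V) : symProdEnd A α v =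
      (k.factorial : ℝ)⁻¹ * ∑ σ : Equiv.Perm (Fin k), α (fun i => A (σ i) (v i)) := by
  rw [symProdEnd, ContinuousAlternatingMap.smul_apply, smul_eq_mul,
    ContinuousMultilinearMap.alternatization_apply_apply]
  congr 1
  refine Fintype.sum_equiv (Equiv.inv _) _ _ fun σ => ?_
  have h := α.toAlternatingMap.map_perm (fun i => A i (v (σ i))) σ⁻¹
  have h2 : α (fun i => A i (v (σ i))) =
      (Equiv.Perm.sign σ) • α (fun i => A (σ⁻¹ i) (v i)) := by
    have h3 : (fun i => A i (v (σ i))) ∘ (σ⁻¹ : Equiv.Perm (Fin k)) =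
      fun i => A (σ⁻¹ i) (v i) := by
      ext1 i; simp
    rw [h3, Equiv.Perm.sign_inv] at h
    have h4 : α (fun i => A (σ⁻¹ i) (v i)) = Equiv.Perm.sign σ • α (fun i => A i (v (σ i))) := h
    rw [h4, smul_smul, Int.units_mul_self, one_smul]
  change Equiv.Perm.sign σ • α (fun i => A i (v (σ i))) = _
  rw [h2, smul_smul, Int.units_mul_self, one_smul]
  rfl

end Exterior

/-- The projection onto the `i`-th summand of an internal direct sum of submodules. -/
def internalProj {R N ι : Type*} [CommRing R] [AddCommGroup N] [Module R N] [DecidableEq ι]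
    {A : ι → Submodule R N} (h : DirectSum.IsInternal A) (i : ι) : N →ₗ[R] N :=
  (A i).subtype ∘ₗ DirectSum.component R ι (fun i => A i) i ∘ₗ
    (LinearEquiv.ofBijective (DirectSum.coeLinearMap A) h).symm.toLinearMap

section Contact

variable {n m : ℕ} {M E : Type*} [TopologicalSpace M] [ChartedSpace (Eu n) M]
  [TopologicalSpace E] [ChartedSpace (Eu (n + m)) E] [IsManifold (𝓡 n) ∞ M]
  [IsManifold (𝓡 (n + m)) ∞ E] {π : FibredManifold n m M E} {r : ℕ}

open Classical in
/-- The prolongation `j_r s : M → J^r π` of a local section `s` (with a junk value away from the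
open set on which `s` is a smooth section). -/
def LocalSection.prolong (r : ℕ) (g : LocalSection π) (x : M) : JetSpace π r :=
  if h : IsSectionNear π g.toFun x then LocalSection.jet r ⟨x, g.toFun, h⟩ else g.jet r

theorem JetSpace.prolong_rep (θ : JetSpace π (r + 1)) :
    θ.rep.prolong r θ.toBase = θ.toLower ∧ θ.toLower.toBase = θ.toBase := by
  have hb : θ.rep.base = θ.toBase := by
    conv_rhs => rw [← θ.jet_rep]
    rfl
  have hl : θ.rep.jet r = θ.toLower := by
    conv_rhs => rw [← θ.jet_rep]
    rfl
  refine ⟨?_, ?_⟩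
  · rw [← hb, LocalSection.prolong, dif_pos θ.rep.isSection]
    exact hl
  · rw [← hl, ← hb]; rfl

/-- The fibre at `θ ∈ J^{r+1} π` of the pull-back `J^{r+1} π ×_{J^r π} TJ^r π`. -/
abbrev JetTangent (θ : JetSpace π (r + 1)) : Type :=
  TangentSpace 𝓘(ℝ, JetModel n m r) θ.toLower

/-- The contact map `D_{r+1} : J^{r+1} π → T*M ⊗ TJ^r π`: if `θ = j_{r+1} s (x)`, then
`D_{r+1}(θ) = T_x (j_r s) : T_x M → T_{j_r s (x)} J^r π`. -/
def contactMap (θ : JetSpace π (r + 1)) :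
    TangentSpace (𝓡 n) θ.toBase →L[ℝ] JetTangent θ :=
  mfderiv (𝓡 n) 𝓘(ℝ, JetModel n m r) (θ.rep.prolong r) θ.toBase

/-- The tangent map of the projection `J^r π → M`. -/
def tangentProj (θ : JetSpace π (r + 1)) :
    JetTangent θ →L[ℝ] TangentSpace (𝓡 n) θ.toBase :=
  mfderiv 𝓘(ℝ, JetModel n m r) (𝓡 n) (JetSpace.toBase (π := π) (r := r)) θ.toLower

/-- `D_{r+1}` at `θ` as an endomorphism of `T J^r π`. -/
def horEnd (θ : JetSpace π (r + 1)) : JetTangent θ →L[ℝ] JetTangent θ :=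
  (contactMap θ).comp (tangentProj θ)

/-- `ω_{r+1} = id - D_{r+1}` at `θ`. -/
def contactEnd (θ : JetSpace π (r + 1)) : JetTangent θ →L[ℝ] JetTangent θ :=
  ContinuousLinearMap.id ℝ (JetTangent θ) - horEnd θ

/-- The fibre of the bundle `C*_{r+1,r} = im ω*_{r+1}` of contact covectors. -/
def contactFibre (θ : JetSpace π (r + 1)) : Submodule ℝ (JetTangent θ →L[ℝ] ℝ) where
  carrier := {γ | ∃ β : JetTangent θ →L[ℝ] ℝ, γ = β.comp (contactEnd θ)}
  add_mem' := by
    rintro _ _ ⟨β, rfl⟩ ⟨β', rfl⟩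
    exact ⟨β + β', (ContinuousLinearMap.add_comp _ _ _).symm⟩
  zero_mem' := ⟨0, (ContinuousLinearMap.zero_comp _).symm⟩
  smul_mem' := by
    rintro t _ ⟨β, rfl⟩
    exact ⟨t • β, (ContinuousLinearMap.smul_comp _ _ _).symm⟩

/-- The fibre of the bundle `J^{r+1} π ×_M T*M ⊂ J^{r+1} π ×_{J^r π} T*J^r π` of horizontal
covectors. -/
def horizontalFibre (θ : JetSpace π (r + 1)) : Submodule ℝ (JetTangent θ →L[ℝ] ℝ) where
  carrier := {γ | ∃ β : TangentSpace (𝓡 n) θ.toBase →L[ℝ] ℝ, γ = β.comp (tangentProj θ)}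
  add_mem' := by
    rintro _ _ ⟨β, rfl⟩ ⟨β', rfl⟩
    exact ⟨β + β', (ContinuousLinearMap.add_comp _ _ _).symm⟩
  zero_mem' := ⟨0, (ContinuousLinearMap.zero_comp _).symm⟩
  smul_mem' := by
    rintro t _ ⟨β, rfl⟩
    exact ⟨t • β, (ContinuousLinearMap.smul_comp _ _ _).symm⟩

variable (π r)

/-- The algebra `𝓕_r = C^∞(J^r π)`. -/
abbrev JetFun : Type _ :=
  C^∞⟮𝓘(ℝ, JetModel n m r), JetSpace π r; 𝓘(ℝ, ℝ), ℝ⟯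

/-- Not necessarily smooth fields of `k`-covectors on `J^{r+1} π` with values in `∧^k T*J^r π`. -/
def RoughForm (k : ℕ) : Type _ := (θ : JetSpace π (r + 1)) → JetTangent θ [⋀^Fin k]→L[ℝ] ℝ

instance RoughForm.addCommGroup (k : ℕ) : AddCommGroup (RoughForm π r k) :=
  inferInstanceAs (AddCommGroup ((θ : JetSpace π (r + 1)) → JetTangent θ [⋀^Fin k]→L[ℝ] ℝ))

/-- Pointwise multiplication by functions on `J^{r+1} π`. -/
instance RoughForm.module (k : ℕ) : Module (JetFun π (r + 1)) (RoughForm π r k) where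
  smul f α := fun θ => f θ • α θ
  one_smul α := funext fun θ => one_smul ℝ (α θ)
  mul_smul f g α := funext fun θ => mul_smul (f θ) (g θ) (α θ)
  smul_zero f := funext fun θ => smul_zero (f θ)
  smul_add f α β := funext fun θ => smul_add (f θ) (α θ) (β θ)
  add_smul f g α := funext fun θ => add_smul (f θ) (g θ) (α θ)
  zero_smul α := funext fun θ => zero_smul ℝ (α θ)

variable {π r}

/-- The expression of a field of `k`-covectors in the trivialization of `TJ^r π` given by the
chart of `J^r π` around `π^{r+1}_r(θ₀)`. -/
def RoughForm.localExpr {k : ℕ} (α : RoughForm π r k) (θ₀ θ : JetSpace π (r + 1)) :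
    JetModel n m r [⋀^Fin k]→L[ℝ] ℝ :=
  (α θ).compContinuousLinearMap
    ((trivializationAt (JetModel n m r) (TangentSpace 𝓘(ℝ, JetModel n m r))
      θ₀.toLower).symmL ℝ θ.toLower)

/-- Smoothness of a field of `k`-covectors along `π^{r+1}_r`. -/
def RoughForm.IsSmooth {k : ℕ} (α : RoughForm π r k) : Prop :=
  ∀ θ₀ : JetSpace π (r + 1), ContMDiffAt 𝓘(ℝ, JetModel n m (r + 1))
    𝓘(ℝ, JetModel n m r [⋀^Fin k]→L[ℝ] ℝ) ∞ (α.localExpr θ₀) θ₀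

variable (π r)

/-- The `𝓕_{r+1}`-module `Λ^k_{r+1,r}` of (smooth) `k`-forms on `J^{r+1} π` with values in
`∧^k T*J^r π`. -/
def relForms (k : ℕ) : Submodule (JetFun π (r + 1)) (RoughForm π r k) where
  carrier := {α | α.IsSmooth}
  add_mem' := fun {α β} hα hβ θ₀ => (hα θ₀).add (hβ θ₀)
  zero_mem' := fun θ₀ => by
    have h : (0 : RoughForm π r k).localExpr θ₀ = fun _ => 0 := by
      ext θ v; rfl
    rw [h]
    exact contMDiffAt_const
  smul_mem' := fun f α hα θ₀ => (f.contMDiff.contMDiffAt (x := θ₀)).smul (hα θ₀)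

/-- The forms of `Λ^k_{r+1,r}` which take their values in a given family of subspaces. -/
def formsValuedIn (k : ℕ)
    (S : (θ : JetSpace π (r + 1)) → Submodule ℝ (JetTangent θ [⋀^Fin k]→L[ℝ] ℝ)) :
    Submodule (JetFun π (r + 1)) (relForms π r k) where
  carrier := {α | ∀ θ, (α : RoughForm π r k) θ ∈ S θ}
  add_mem' := fun hα hβ θ => (S θ).add_mem (hα θ) (hβ θ)
  zero_mem' := fun θ => (S θ).zero_mem
  smul_mem' := fun f _ hα θ => (S θ).smul_mem (f θ) (hα θ)

/-- The module `𝓒^pΛ^p_{r+1,r}` of forms with values in `∧^p C*_{r+1,r}`. -/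
def contactForms (p : ℕ) : Submodule (JetFun π (r + 1)) (relForms π r p) :=
  formsValuedIn π r p fun θ => extPower p (contactFibre θ)

/-- The module `𝓗Λ^l_{r+1,r}` of forms with values in `∧^l T*M`. -/
def horizontalForms (l : ℕ) : Submodule (JetFun π (r + 1)) (relForms π r l) :=
  formsValuedIn π r l fun θ => extPower l (horizontalFibre θ)

/-- The module `𝓒^pΛ^p_{r+1,r} ∧ 𝓗Λ^l_{r+1}`, `p + l = k`, of sections of the bundle
`∧^p C*_{r+1,r} ∧ ∧^l T*M`. -/
def contactWedgeHorizontal (p l k : ℕ) (h : p + l = k) :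
    Submodule (JetFun π (r + 1)) (relForms π r k) :=
  formsValuedIn π r k fun θ => wedgePowers p l k h (contactFibre θ) (horizontalFibre θ)

/-- The summands `𝓒^{k-l}Λ^{k-l}_{r+1,r} ∧ 𝓗Λ^l_{r+1}`, `0 ≤ l ≤ k`, of the `𝓒`-splitting. -/
def splittingSummand (k : ℕ) (l : Fin (k + 1)) :
    Submodule (JetFun π (r + 1)) (relForms π r k) :=
  contactWedgeHorizontal π r (k - l) l k (Nat.sub_add_cancel (Nat.lt_succ_iff.1 l.2))

end Contact

end

/-! Everything rests on one identity: near `x` the prolongation `j_r s` is a section of `π^r`, so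
`tangentProj θ ∘ contactMap θ = id` (`tangentProj_contactMap`). Hence `D = contactMap θ ∘
tangentProj θ` is idempotent, `ω = id - D` is the complementary idempotent, and the contact and
horizontal covectors are the images of the transposes of `ω` and `D`.

The rest of the pointwise statement is linear algebra for two endomorphisms `A`, `B`. If `A + B =
id`, expanding `α(Av₁ + Bv₁, …, Av_k + Bv_k)` over the sets of slots that receive `A`, and grouping
these sets by their size `p`, writes `α` as the sum of the operators `binom(k, p) ⊙^p A ⊙ ⊙^{k-p} B`
applied to `α` (`sum_splitProj`). On a wedge of covectors such an operator averages over the ways of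
composing `p` factors with `A` and the others with `B` (`symProdEnd_wedgeOneForms`). Its values
therefore lie in the summand with `p` contact factors (`splitProj_mem`), and it kills every other
summand, where some factor always meets the wrong projector (`splitProj_eq_zero`). Operators that
add up to the identity, take values in their own summands and vanish on the others force a direct
sum and are its projections (`isInternal_of_projections`, `internalProj_eq`).

To pass from fibres to modules of smooth forms, the operators must preserve smoothness. This follows
once `D` depends smoothly on `θ`. In jet coordinates the derivative of `j_r s` depends only on the
`(r+1)`-jet of `s`, so the arbitrary representative can be replaced by its Taylor polynomial, which
varies smoothly with the jet (`contDiff_horModel`, `JetSpace.eventually_horEnd_eq`). -/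

noncomputable section

/-! ### Decomposable forms, wedge products and symmetric products of endomorphisms -/

section ExteriorAlgebra

variable {V : Type*} [AddCommGroup V] [Module ℝ V] [TopologicalSpace V]

theorem wedgeOneForms_apply {k : ℕ} (β : Fin k → V →L[ℝ] ℝ) (v : Fin k → V) :
    wedgeOneForms β v = (Matrix.of fun j i => β i (v j)).det := by
  rw [wedgeOneForms, ContinuousMultilinearMap.alternatization_apply_apply, Matrix.det_apply]
  simp

theorem wedgeOneForms_comp_perm {k : ℕ} (β : Fin k → V →L[ℝ] ℝ) (σ : Equiv.Perm (Fin k)) :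
    wedgeOneForms (β ∘ σ) = (Equiv.Perm.sign σ : ℤ) • wedgeOneForms β := by
  ext v
  rw [ContinuousAlternatingMap.smul_apply, wedgeOneForms_apply, wedgeOneForms_apply]
  have h := Matrix.det_permute' σ (Matrix.of fun j i => β i (v j))
  rw [zsmul_eq_mul, ← h]
  rfl

theorem wedgeOneForms_eq_zero {k : ℕ} {β : Fin k → V →L[ℝ] ℝ} (i : Fin k) (h : β i = 0) :
    wedgeOneForms β = 0 := by
  ext v
  rw [wedgeOneForms_apply]
  exact Matrix.det_eq_zero_of_column_eq_zero i fun j => by simp [h]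

theorem wedgeOneForms_compContinuousLinearMap {k : ℕ} (β : Fin k → V →L[ℝ] ℝ) (f : V →L[ℝ] V) :
    (wedgeOneForms β).compContinuousLinearMap f = wedgeOneForms fun i => (β i).comp f := by
  ext v
  rw [ContinuousAlternatingMap.compContinuousLinearMap_apply, wedgeOneForms_apply,
    wedgeOneForms_apply]
  rfl

/-- The symmetric product of endomorphisms, as a linear endomorphism of `∧^k V*`. -/
def symProdEndₗ {k : ℕ} (A : Fin k → V →L[ℝ] V) :
    (V [⋀^Fin k]→L[ℝ] ℝ) →ₗ[ℝ] (V [⋀^Fin k]→L[ℝ] ℝ) where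
  toFun := symProdEnd A
  map_add' α β := by
    ext v
    simp only [symProdEnd_apply, ContinuousAlternatingMap.add_apply, Finset.sum_add_distrib,
      mul_add]
  map_smul' c α := by
    ext v
    simp only [symProdEnd_apply, ContinuousAlternatingMap.smul_apply, smul_eq_mul,
      RingHom.id_apply, ← Finset.mul_sum]
    ring

theorem symProdEnd_const {k : ℕ} (A : V →L[ℝ] V) (α : V [⋀^Fin k]→L[ℝ] ℝ) :
    symProdEnd (fun _ => A) α = α.compContinuousLinearMap A := by
  ext v
  rw [symProdEnd_apply, Finset.sum_const, Finset.card_univ, Fintype.card_perm, Fintype.card_fin,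
    nsmul_eq_mul, inv_mul_cancel_left₀ (by positivity)]
  rfl

/-- Averaging over the slots is the same as averaging over the factors. This turns every question
about `symProdEnd` into one about which endomorphism meets which covector. -/
theorem symProdEnd_wedgeOneForms {k : ℕ} (A : Fin k → V →L[ℝ] V) (β : Fin k → V →L[ℝ] ℝ) :
    symProdEnd A (wedgeOneForms β) = (k.factorial : ℝ)⁻¹ •
      ∑ σ : Equiv.Perm (Fin k), wedgeOneForms fun i => (β i).comp (A (σ i)) := by
  ext v
  rw [symProdEnd_apply, ContinuousAlternatingMap.smul_apply, ContinuousAlternatingMap.sum_apply,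
    smul_eq_mul]
  congr 1
  simp only [wedgeOneForms_apply, Matrix.det_apply, Matrix.of_apply]
  rw [Finset.sum_comm]
  conv_rhs => rw [Finset.sum_comm]
  refine Finset.sum_congr rfl fun τ _ => ?_
  -- In the determinant term of `τ`, factor `i` is evaluated in slot `τ i`, which carries `A (σ (τ
  -- i))`; replacing `σ * τ` by `σ` attaches the endomorphism to the factor.
  refine Fintype.sum_equiv (Equiv.mulRight τ) _ _ fun σ => ?_
  rfl

theorem wedge_apply {p q : ℕ} (a : V [⋀^Fin p]→L[ℝ] ℝ) (b : V [⋀^Fin q]→L[ℝ] ℝ)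
    (v : Fin (p + q) → V) : wedge a b v = ((p.factorial : ℝ) * (q.factorial : ℝ))⁻¹ *
      ∑ σ : Equiv.Perm (Fin (p + q)), (Equiv.Perm.sign σ : ℤ) •
        (a (fun i => v (σ (Fin.castAdd q i))) * b (fun j => v (σ (Fin.natAdd p j)))) := by
  rw [wedge, ContinuousAlternatingMap.smul_apply, smul_eq_mul,
    ContinuousMultilinearMap.alternatization_apply_apply]
  rfl

/-- The wedge product as a bilinear map. -/
def wedgeₗ (p q : ℕ) : (V [⋀^Fin p]→L[ℝ] ℝ) →ₗ[ℝ] (V [⋀^Fin q]→L[ℝ] ℝ) →ₗ[ℝ]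
    (V [⋀^Fin (p + q)]→L[ℝ] ℝ) :=
  LinearMap.mk₂ ℝ wedge
    (fun a a' b => by
      ext v
      simp only [wedge_apply, ContinuousAlternatingMap.add_apply, add_mul, smul_add,
        Finset.sum_add_distrib, mul_add])
    (fun c a b => by
      ext v
      simp only [wedge_apply, ContinuousAlternatingMap.smul_apply, smul_eq_mul, Finset.mul_sum,
        zsmul_eq_mul]
      exact Finset.sum_congr rfl fun _ _ => by ring)
    (fun a b b' => by
      ext v
      simp only [wedge_apply, ContinuousAlternatingMap.add_apply, smul_add,
        Finset.sum_add_distrib, mul_add])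
    (fun c a b => by
      ext v
      simp only [wedge_apply, ContinuousAlternatingMap.smul_apply, smul_eq_mul, Finset.mul_sum,
        zsmul_eq_mul]
      exact Finset.sum_congr rfl fun _ _ => by ring)

/-- Expanding both determinants inside the sum over `σ` counts the full determinant once for each
pair in `S_p × S_q`, and the normalization `1 / (p! q!)` cancels exactly this multiplicity. -/
theorem wedge_wedgeOneForms {p q : ℕ} (c : Fin p → V →L[ℝ] ℝ) (h : Fin q → V →L[ℝ] ℝ) :
    wedge (wedgeOneForms c) (wedgeOneForms h) = wedgeOneForms (Fin.append c h) := by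
  ext v
  rw [wedge_apply]
  -- The block embedding of `S_p × S_q` in `S_{p+q}`; it is multiplicative on signs.
  let J : Equiv.Perm (Fin p) → Equiv.Perm (Fin q) → Equiv.Perm (Fin (p + q)) := fun τ ρ =>
    finSumFinEquiv.permCongr (Equiv.sumCongr τ ρ)
  have hJl : ∀ τ ρ i, J τ ρ (Fin.castAdd q i) = Fin.castAdd q (τ i) := fun τ ρ i => by
    simp [J, Equiv.permCongr_apply]
  have hJr : ∀ τ ρ i, J τ ρ (Fin.natAdd p i) = Fin.natAdd p (ρ i) := fun τ ρ i => by
    simp [J, Equiv.permCongr_apply]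
  have hJs : ∀ τ ρ, Equiv.Perm.sign (J τ ρ) = Equiv.Perm.sign τ * Equiv.Perm.sign ρ :=
    fun τ ρ => by
      rw [Equiv.Perm.sign_permCongr]; exact Equiv.Perm.sign_sumCongr τ ρ
  let F : Equiv.Perm (Fin (p + q)) → ℝ := fun σ =>
    (Equiv.Perm.sign σ : ℤ) • ∏ i, Fin.append c h i (v (σ i))
  have hF : wedgeOneForms (Fin.append c h) v = ∑ σ, F σ := by
    rw [wedgeOneForms_apply, Matrix.det_apply]; rfl
  have key : ∀ σ : Equiv.Perm (Fin (p + q)), (Equiv.Perm.sign σ : ℤ) •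
        (wedgeOneForms c (fun i => v (σ (Fin.castAdd q i))) *
          wedgeOneForms h (fun j => v (σ (Fin.natAdd p j)))) =
      ∑ τ : Equiv.Perm (Fin p), ∑ ρ : Equiv.Perm (Fin q), F (σ * J τ ρ) := by
    intro σ
    simp only [wedgeOneForms_apply, Matrix.det_apply, Matrix.of_apply, Finset.sum_mul_sum,
      Finset.smul_sum]
    refine Finset.sum_congr rfl fun τ _ => Finset.sum_congr rfl fun ρ _ => ?_
    simp only [F, Fin.prod_univ_add, Equiv.Perm.mul_apply, hJl, hJr, Fin.append_left,
      Fin.append_right, Equiv.Perm.sign_mul, hJs, Units.smul_def, zsmul_eq_mul]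
    push_cast
    ring
  rw [hF, Finset.sum_congr rfl fun σ _ => key σ, Finset.sum_comm]
  have h1 : ∀ τ : Equiv.Perm (Fin p), ∑ σ, ∑ ρ : Equiv.Perm (Fin q), F (σ * J τ ρ) =
      q.factorial * ∑ σ, F σ := by
    intro τ
    rw [Finset.sum_comm]
    -- Right translation by a block permutation leaves the sum over the whole group unchanged.
    have h2 : ∀ ρ : Equiv.Perm (Fin q), ∑ σ, F (σ * J τ ρ) = ∑ σ, F σ := fun ρ =>
      Fintype.sum_equiv (Equiv.mulRight (J τ ρ)) _ _ fun _ => rfl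
    simp [h2, Fintype.card_perm]
  simp only [h1, Finset.sum_const, Finset.card_univ, Fintype.card_perm, Fintype.card_fin,
    nsmul_eq_mul]
  field_simp

variable {p q k : ℕ} {U W : Submodule ℝ (V →L[ℝ] ℝ)}

/-- `∧^p U ∧ ∧^q W` is spanned by the products of `p` covectors in `U` and `q` covectors in `W`. -/
theorem wedgePowers_eq_span (h : p + q = k) : wedgePowers p q k h U W =
    Submodule.span ℝ {γ | ∃ β : Fin k → V →L[ℝ] ℝ, (∀ i : Fin k, (i : ℕ) < p → β i ∈ U) ∧
      (∀ i : Fin k, p ≤ (i : ℕ) → β i ∈ W) ∧ γ = wedgeOneForms β} := by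
  subst h
  refine le_antisymm (Submodule.span_le.2 ?_) (Submodule.span_le.2 ?_)
  · rintro _ ⟨a, ha, b, hb, rfl⟩
    -- By bilinearity of the wedge product it is enough to treat two decomposable forms.
    refine Submodule.span_induction₂ (p := fun a b _ _ => wedgeₗ p q a b ∈ Submodule.span ℝ _)
      ?_ ?_ ?_ ?_ ?_ ?_ ?_ ha hb
    · rintro _ _ ⟨c, hc, rfl⟩ ⟨d, hd, rfl⟩
      refine Submodule.subset_span ⟨Fin.append c d, ?_, ?_, wedge_wedgeOneForms c d⟩
      · intro i hi
        refine i.addCases (fun i _ => ?_) (fun i hi => ?_) hi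
        · rw [Fin.append_left]; exact hc i
        · simp at hi
      · intro i hi
        refine i.addCases (fun i hi => ?_) (fun i hi => ?_) hi
        · exact absurd hi (by simp)
        · rw [Fin.append_right]; exact hd i
    · intro b _
      rw [LinearMap.map_zero₂]; exact Submodule.zero_mem _
    · intro a _
      rw [map_zero]; exact Submodule.zero_mem _
    · intro a a' b _ _ _ h h'
      rw [LinearMap.map_add₂]; exact Submodule.add_mem _ h h'
    · intro a b b' _ _ _ h h'
      rw [map_add]; exact Submodule.add_mem _ h h'
    · intro t a b _ _ h
      rw [LinearMap.map_smul₂]; exact Submodule.smul_mem _ t h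
    · intro t a b _ _ h
      rw [map_smul]; exact Submodule.smul_mem _ t h
  · rintro _ ⟨β, hU, hW, rfl⟩
    refine Submodule.subset_span ⟨wedgeOneForms fun i => β (Fin.castAdd q i),
      Submodule.subset_span ⟨_, fun i => hU _ (by simp), rfl⟩,
      wedgeOneForms fun i => β (Fin.natAdd p i),
      Submodule.subset_span ⟨_, fun i => hW _ (by simp), rfl⟩, ?_⟩
    rw [wedge_wedgeOneForms]
    exact congrArg wedgeOneForms (Fin.append_castAdd_natAdd (f := β)).symm

section Spanning
variable [IsTopologicalAddGroup V] [ContinuousSMul ℝ V] [T2Space V] [FiniteDimensional ℝ V]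

/-- With a basis `b` and its dual basis `d`, `α = (1 / k!) ∑_f α(b_f) d_{f 1} ∧ ⋯ ∧ d_{f k}`. The
sum runs over all index maps `f`, not only the increasing ones, which accounts for the factor `1 /
k!`. -/
theorem span_wedgeOneForms (k : ℕ) :
    Submodule.span ℝ (Set.range (wedgeOneForms (V := V) (k := k))) = ⊤ := by
  refine eq_top_iff.2 fun α _ => ?_
  let b := Module.finBasis ℝ V
  let d : Fin (Module.finrank ℝ V) → V →L[ℝ] ℝ := fun i => (b.coord i).toContinuousLinearMap
  have hα : α = (k.factorial : ℝ)⁻¹ • ∑ f : Fin k → Fin (Module.finrank ℝ V),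
      α (fun i => b (f i)) • wedgeOneForms fun i => d (f i) := by
    ext v
    have h1 : ∀ σ : Equiv.Perm (Fin k), (Equiv.Perm.sign σ : ℤ) • α (fun i => v (σ i)) = α v := by
      intro σ
      have h := α.toAlternatingMap.map_perm v σ
      have h2 : α (fun i => v (σ i)) = Equiv.Perm.sign σ • α v := h
      rw [h2, Units.smul_def, smul_smul, Int.units_coe_mul_self, one_smul]
    have h2 : ∀ w : Fin k → V, α w = ∑ f : Fin k → Fin (Module.finrank ℝ V),
        (∏ i, d (f i) (w i)) * α (fun i => b (f i)) := by
      intro w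
      have e : w = fun i => ∑ j, b.repr (w i) j • b j := by
        ext1 i; exact (b.sum_repr (w i)).symm
      conv_lhs => rw [e]
      have h := α.toMultilinearMap.map_sum (fun (i : Fin k) j => b.repr (w i) j • b j)
      refine Eq.trans h (Finset.sum_congr rfl fun f _ => ?_)
      exact α.toMultilinearMap.map_smul_univ (fun i => b.repr (w i) (f i)) (fun i => b (f i))
    -- The alternating form is written as its own antisymmetrization, so that the basis expansions
    -- of the terms assemble into the determinants of the `d (f i)`.
    have h3 : (k.factorial : ℝ) * α v = ∑ σ : Equiv.Perm (Fin k),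
        (Equiv.Perm.sign σ : ℤ) • α (fun i => v (σ i)) := by
      simp only [h1, Finset.sum_const, Finset.card_univ, Fintype.card_perm, Fintype.card_fin,
        nsmul_eq_mul]
    rw [ContinuousAlternatingMap.smul_apply, ContinuousAlternatingMap.sum_apply, smul_eq_mul,
      eq_inv_mul_iff_mul_eq₀ (by positivity), h3]
    simp only [h2 fun i => v _, ContinuousAlternatingMap.smul_apply, wedgeOneForms_apply,
      Matrix.det_apply, Matrix.of_apply, Finset.smul_sum]
    rw [Finset.sum_comm]
    refine Finset.sum_congr rfl fun f _ => Finset.sum_congr rfl fun σ _ => ?_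
    simp only [Units.smul_def, zsmul_eq_mul, smul_eq_mul]
    ring
  rw [hα]
  exact Submodule.smul_mem _ _ (Submodule.sum_mem _ fun f _ =>
    Submodule.smul_mem _ _ (Submodule.subset_span ⟨_, rfl⟩))

end Spanning

end ExteriorAlgebra

/-! ### The binomial operators attached to a pair of endomorphisms -/

section Splitting

variable {V : Type*} [AddCommGroup V] [Module ℝ V] [TopologicalSpace V]

/-- The operator `binom k p ⊙^p A ⊙ ⊙^{k-p} B`. -/
def splitProj (A B : V →L[ℝ] V) (k p : ℕ) :
    (V [⋀^Fin k]→L[ℝ] ℝ) →ₗ[ℝ] (V [⋀^Fin k]→L[ℝ] ℝ) :=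
  (k.choose p : ℝ) • symProdEndₗ fun i : Fin k => if (i : ℕ) < p then A else B

theorem splitProj_apply (A B : V →L[ℝ] V) (k p : ℕ) (α : V [⋀^Fin k]→L[ℝ] ℝ) :
    splitProj A B k p α = (k.choose p : ℝ) •
      symProdEnd (fun i : Fin k => if (i : ℕ) < p then A else B) α := rfl

/-- Sum over subsets of fixed size, as a normalized sum over permutations. -/
theorem sum_powersetCard_eq_sum_perm {k p : ℕ} (hp : p ≤ k) (f : Finset (Fin k) → ℝ) :
    ∑ S ∈ Finset.powersetCard p Finset.univ, f S = (k.choose p : ℝ) * ((k.factorial : ℝ)⁻¹ *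
      ∑ σ : Equiv.Perm (Fin k), f {i | (σ i : ℕ) < p}) := by
  let S₀ : Finset (Fin k) := {i | (i : ℕ) < p}
  have hS₀ : S₀.card = p := by
    simp only [S₀]
    rw [Fin.card_filter_val_lt]; omega
  -- Double counting of `f (σ S)` over pairs `(S, σ)`. For fixed `S` the sum over `σ` does not
  -- depend on `S`, because some `ρ` carries `S` to the initial segment `S₀`.
  have h1 : ∀ S ∈ Finset.powersetCard p (Finset.univ : Finset (Fin k)),
      ∑ σ : Equiv.Perm (Fin k), f (S.map σ.toEmbedding) =
        ∑ σ : Equiv.Perm (Fin k), f {i | (σ i : ℕ) < p} := by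
    intro S hS
    have hc : S.card = S₀.card := by rw [(Finset.mem_powersetCard.1 hS).2, hS₀]
    let e : {x // x ∈ S} ≃ {x // x ∈ S₀} := Finset.equivOfCardEq hc
    let ρ : Equiv.Perm (Fin k) := e.extendSubtype
    have hρ : S.map ρ.toEmbedding = S₀ := by
      refine Finset.eq_of_subset_of_card_le (fun x hx => ?_) (by rw [Finset.card_map, hc])
      obtain ⟨y, hy, rfl⟩ := Finset.mem_map.1 hx
      exact e.extendSubtype_mem y hy
    -- The substitution sends `σ` to `ρ σ⁻¹`, and `ρ σ⁻¹ i ∈ S₀` means `i ∈ σ S`.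
    refine Fintype.sum_equiv ((Equiv.mulRight ρ⁻¹).trans (Equiv.inv _)) _ _ fun σ => ?_
    congr 1
    ext x
    simp only [Equiv.trans_apply, Equiv.coe_mulRight, Equiv.inv_apply, mul_inv_rev, inv_inv,
      Finset.mem_map_equiv, Finset.mem_filter, Finset.mem_univ, true_and, Equiv.Perm.mul_apply]
    have : ρ (σ⁻¹ x) ∈ S₀ ↔ σ⁻¹ x ∈ S := by
      rw [← hρ]; simp
    simp only [S₀, Finset.mem_filter, Finset.mem_univ, true_and] at this
    exact this.symm
  -- For fixed `σ`, the map `S ↦ σ S` permutes the subsets of size `p`. Comparing the two counts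
  -- gives `k! ∑_S f S = binom(k, p) ∑_σ f {i | σ i < p}`.
  have h2 : ∀ σ : Equiv.Perm (Fin k),
      ∑ S ∈ Finset.powersetCard p (Finset.univ : Finset (Fin k)), f (S.map σ.toEmbedding) =
        ∑ S ∈ Finset.powersetCard p (Finset.univ : Finset (Fin k)), f S := by
    intro σ
    refine Finset.sum_equiv σ.finsetCongr (fun S => ?_) (fun S _ => rfl)
    simp [Finset.mem_powersetCard]
  have h3 := Finset.sum_congr rfl h1
  rw [Finset.sum_comm, Finset.sum_congr rfl fun σ _ => h2 σ, Finset.sum_const, Finset.sum_const,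
    Finset.card_powersetCard, Finset.card_univ, Finset.card_univ, Fintype.card_perm,
    Fintype.card_fin, nsmul_eq_mul, nsmul_eq_mul] at h3
  rw [mul_left_comm, ← h3, inv_mul_cancel_left₀ (by positivity)]

/-- A permutation enters `symProdEnd` only through the set of slots that it sends below `p`. The
binomial coefficient is what turns the average over permutations into a plain sum over these sets.
-/
theorem splitProj_apply_apply (A B : V →L[ℝ] V) {k p : ℕ} (hp : p ≤ k)
    (α : V [⋀^Fin k]→L[ℝ] ℝ) (v : Fin k → V) : splitProj A B k p α v =
      ∑ S ∈ Finset.powersetCard p Finset.univ,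
        α (S.piecewise (fun i => A (v i)) fun i => B (v i)) := by
  rw [sum_powersetCard_eq_sum_perm hp, splitProj_apply, ContinuousAlternatingMap.smul_apply,
    symProdEnd_apply, smul_eq_mul]
  congr 3
  ext1 σ
  congr 1
  ext1 i
  simp only [Finset.piecewise, Finset.mem_filter, Finset.mem_univ, true_and]
  split_ifs <;> rfl

/-- This is the multilinear expansion of `α` at `v = Av + Bv`, with the subsets of slots grouped by
cardinality. -/
theorem sum_splitProj {A B : V →L[ℝ] V} (hAB : ∀ v, A v + B v = v) (k : ℕ)
    (α : V [⋀^Fin k]→L[ℝ] ℝ) : ∑ l : Fin (k + 1), splitProj A B k (k - l) α = α := by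
  ext v
  rw [ContinuousAlternatingMap.sum_apply,
    Finset.sum_congr rfl fun (l : Fin (k + 1)) _ =>
      splitProj_apply_apply A B (Nat.sub_le k l) α v,
    Fin.sum_univ_eq_sum_range (fun l => ∑ S ∈ Finset.powersetCard (k - l) Finset.univ,
        α (S.piecewise (fun i => A (v i)) fun i => B (v i)))]
  -- The summands are indexed by the horizontal degree `l`, the subsets by the contact degree `p = k
  -- - l`.
  have h0 := Finset.sum_range_reflect (fun p => ∑ S ∈ Finset.powersetCard p Finset.univ,
    α (S.piecewise (fun i => A (v i)) fun i => B (v i))) (k + 1)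
  rw [Nat.add_sub_cancel] at h0
  rw [h0]
  have h := α.toAlternatingMap.map_add_univ (fun i => A (v i)) (fun i => B (v i))
  have hv : ((fun i => A (v i)) + fun i => B (v i)) = v := by
    ext1 i; exact hAB (v i)
  rw [hv] at h
  refine Eq.trans ?_ h.symm
  have h2 := Finset.sum_powerset (Finset.univ : Finset (Fin k))
    (fun S => α (S.piecewise (fun i => A (v i)) fun i => B (v i)))
  rw [Finset.card_univ, Fintype.card_fin, Finset.powerset_univ] at h2
  exact h2.symm

section
variable {A B : V →L[ℝ] V} {U W : Submodule ℝ (V →L[ℝ] ℝ)}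

/-- On a wedge of `p'` covectors of `U` and `q` of `W`, a term of the average survives only if `A`
meets exactly the factors in `U`. As `A` occurs `p` times, this would give `p = p'`. -/
theorem splitProj_eq_zero {k p p' q : ℕ} (h : p' + q = k) (hp : p ≤ k) (hpp : p ≠ p')
    (hUB : ∀ β ∈ U, β.comp B = 0) (hWA : ∀ β ∈ W, β.comp A = 0)
    {α : V [⋀^Fin k]→L[ℝ] ℝ} (hα : α ∈ wedgePowers p' q k h U W) :
    splitProj A B k p α = 0 := by
  rw [wedgePowers_eq_span] at hα
  rw [← LinearMap.mem_ker]
  revert α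
  change Submodule.span ℝ _ ≤ LinearMap.ker (splitProj A B k p)
  refine Submodule.span_le.2 ?_
  rintro _ ⟨β, hU, hW, rfl⟩
  change splitProj A B k p _ = 0
  rw [splitProj_apply, symProdEnd_wedgeOneForms, Finset.sum_eq_zero, smul_zero, smul_zero]
  intro σ _
  by_contra hne
  have h1 : ∀ i : Fin k, ((i : ℕ) < p' ↔ (σ i : ℕ) < p) := by
    intro i
    by_contra hi
    refine hne (wedgeOneForms_eq_zero i ?_)
    by_cases hi' : (i : ℕ) < p'
    · rw [if_neg (by tauto)]; exact hUB _ (hU i hi')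
    · rw [if_pos (by tauto)]; exact hWA _ (hW i (not_lt.1 hi'))
  -- A surviving `σ` maps the first `p'` indices onto the first `p`. Since `p` and `p'` are at most
  -- `k`, these sets have sizes `p'` and `p`.
  have h2 : (Finset.univ.filter fun i : Fin k => (i : ℕ) < p').map σ.toEmbedding =
      Finset.univ.filter fun i : Fin k => (i : ℕ) < p := by
    ext x
    simp only [Finset.mem_map_equiv, Finset.mem_filter, Finset.mem_univ, true_and, h1,
      Equiv.apply_symm_apply]
  have h3 := congrArg Finset.card h2
  rw [Finset.card_map, Fin.card_filter_val_lt, Fin.card_filter_val_lt] at h3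
  omega

section
variable [IsTopologicalAddGroup V] [ContinuousSMul ℝ V] [T2Space V] [FiniteDimensional ℝ V]

/-- Decomposable forms span, and on them each term of the average has `p` factors of the form `β ∘
A` and `q` of the form `β ∘ B`. -/
theorem splitProj_mem {k p q : ℕ} (h : p + q = k) (hU : ∀ β : V →L[ℝ] ℝ, β.comp A ∈ U)
    (hW : ∀ β : V →L[ℝ] ℝ, β.comp B ∈ W) (α : V [⋀^Fin k]→L[ℝ] ℝ) :
    splitProj A B k p α ∈ wedgePowers p q k h U W := by
  have hα : α ∈ Submodule.span ℝ (Set.range (wedgeOneForms (V := V) (k := k))) := by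
    rw [span_wedgeOneForms]; trivial
  suffices hle : Submodule.span ℝ (Set.range (wedgeOneForms (V := V) (k := k))) ≤
    (wedgePowers p q k h U W).comap (splitProj A B k p) from
    hle hα
  refine Submodule.span_le.2 ?_
  rintro _ ⟨β, rfl⟩
  change splitProj A B k p (wedgeOneForms β) ∈ wedgePowers p q k h U W
  rw [splitProj_apply, symProdEnd_wedgeOneForms, wedgePowers_eq_span]
  refine Submodule.smul_mem _ _ (Submodule.smul_mem _ _ (Submodule.sum_mem _ fun σ _ => ?_))
  -- Reordering the factors by `σ` brings those composed with `A` to the front, at the cost of a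
  -- sign that the span absorbs.
  have e : (fun i : Fin k => (β i).comp (if (σ i : ℕ) < p then A else B)) =
      (fun i : Fin k => (β (σ⁻¹ i)).comp (if (i : ℕ) < p then A else B)) ∘ σ := by
    ext1 i; simp
  rw [e, wedgeOneForms_comp_perm]
  refine zsmul_mem ?_ _
  refine Submodule.subset_span ⟨_, ?_, ?_, rfl⟩
  · intro i hi
    rw [if_pos hi]; exact hU _
  · intro i hi
    rw [if_neg (not_lt.2 hi)]; exact hW _

/-- Pull-back along `A` is linear in the form and acts factor by factor on decomposable forms. With
the companion statement for elements of `extPower k U`, it serves the splitting of `1`-forms. -/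
theorem compContinuousLinearMap_mem_extPower {k : ℕ} (hU : ∀ β : V →L[ℝ] ℝ, β.comp A ∈ U)
    (α : V [⋀^Fin k]→L[ℝ] ℝ) : α.compContinuousLinearMap A ∈ extPower k U := by
  have hα : α ∈ Submodule.span ℝ (Set.range (wedgeOneForms (V := V) (k := k))) := by
    rw [span_wedgeOneForms]; trivial
  rw [← symProdEnd_const]
  suffices hle : Submodule.span ℝ (Set.range (wedgeOneForms (V := V) (k := k))) ≤
    (extPower k U).comap (symProdEndₗ fun _ => A) from
    hle hα
  refine Submodule.span_le.2 ?_
  rintro _ ⟨β, rfl⟩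
  change symProdEnd (fun _ => A) (wedgeOneForms β) ∈ extPower k U
  rw [symProdEnd_const, wedgeOneForms_compContinuousLinearMap]
  exact Submodule.subset_span ⟨_, fun i => hU _, rfl⟩

end

theorem compContinuousLinearMap_of_mem_extPower {k : ℕ} (hU : ∀ β ∈ U, β.comp A = β)
    {α : V [⋀^Fin k]→L[ℝ] ℝ} (hα : α ∈ extPower k U) : α.compContinuousLinearMap A = α := by
  rw [← symProdEnd_const]
  suffices hle : extPower k U ≤ LinearMap.eqLocus (symProdEndₗ fun _ => A) LinearMap.id from
    hle hα
  refine Submodule.span_le.2 ?_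
  rintro _ ⟨β, hβ, rfl⟩
  change symProdEnd (fun _ => A) (wedgeOneForms β) = wedgeOneForms β
  rw [symProdEnd_const, wedgeOneForms_compContinuousLinearMap]
  exact congrArg wedgeOneForms (funext fun i => hU _ (hβ i))

end

end Splitting

/-! ### The prolongation of maps `ℝⁿ → ℝᵐ` and the coordinate form of `D` -/

section JetExt

variable {n m : ℕ}

/-- The fibres of `T J^r π` must be finite-dimensional for decomposable forms to span. -/
instance SymTensor.finiteDimensional (n m k : ℕ) : FiniteDimensional ℝ (SymTensor n m k) := by
  let f : SymTensor n m k →ₗ[ℝ] MultilinearMap ℝ (fun _ : Fin k => Eu n) (Eu m) :=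
    { toFun := fun A => A.toMulti.toMultilinearMap
      map_add' := fun _ _ => rfl
      map_smul' := fun _ _ => rfl }
  refine Module.Finite.of_injective f fun A B h => SymTensor.toMulti_injective ?_
  exact ContinuousMultilinearMap.toMultilinearMap_injective h

/-- The coordinate expression of the `r`-jet prolongation of a map `ℝⁿ → ℝᵐ`. -/
def jetExt (r : ℕ) (f : Eu n → Eu m) (y : Eu n) : JetModel n m r :=
  (y, fun k : Fin (r + 1) => symProj n m k (iteratedFDeriv ℝ k f y))

theorem hasFDerivAt_jetExt {r : ℕ} {f : Eu n → Eu m} {y : Eu n} (hf : ContDiffAt ℝ ∞ f y) :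
    HasFDerivAt (jetExt r f) ((ContinuousLinearMap.id ℝ (Eu n)).prod
      (ContinuousLinearMap.pi fun k : Fin (r + 1) =>
        (symProj n m k).comp (fderiv ℝ (iteratedFDeriv ℝ k f) y))) y := by
  refine (hasFDerivAt_id y).prodMk (hasFDerivAt_pi.2 fun k => ?_)
  have hd : DifferentiableAt ℝ (iteratedFDeriv ℝ k f) y :=
    (hf.iteratedFDeriv_right (m := 1) (i := k) (by exact_mod_cast le_top)).differentiableAt
      (by simp)
  exact (symProj n m k).hasFDerivAt.comp y hd.hasFDerivAt

/-- The parameter is there for the Taylor polynomial, whose coefficients move with the jet. -/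
theorem contDiffAt_jetExt_uncurry {P : Type*} [NormedAddCommGroup P] [NormedSpace ℝ P] (r : ℕ)
    {G : P → Eu n → Eu m} {p : P} {y : Eu n} (hG : ContDiffAt ℝ ∞ (Function.uncurry G) (p, y)) :
    ContDiffAt ℝ ∞ (Function.uncurry fun q y => jetExt r (G q) y) (p, y) := by
  refine contDiffAt_snd.prodMk (contDiffAt_pi.2 fun k => ?_)
  exact (contDiff_symProj n m k).contDiffAt.comp (p, y) (jetAux_contDiffAt_iteratedFDeriv hG k)

theorem contDiffAt_jetExt {r : ℕ} {f : Eu n → Eu m} {y : Eu n} (hf : ContDiffAt ℝ ∞ f y) :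
    ContDiffAt ℝ ∞ (jetExt r f) y := by
  have h : ContDiffAt ℝ ∞ (Function.uncurry fun (_ : ℝ) y => f y) (0, y) :=
    ContDiffAt.comp (0, y) (g := f) hf contDiffAt_snd
  exact ContDiffAt.comp y (f := fun y : Eu n => ((0 : ℝ), y)) (contDiffAt_jetExt_uncurry r h)
    (contDiffAt_const.prodMk contDiffAt_id)

/-- The derivative of the `r`-jet prolongation only depends on the `(r+1)`-jet. -/
theorem SameJet.fderiv_jetExt_eq {r : ℕ} {f g : Eu n → Eu m} {y : Eu n}
    (h : SameJet (r + 1) f g y) (hf : ContDiffAt ℝ ∞ f y) (hg : ContDiffAt ℝ ∞ g y) :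
    fderiv ℝ (jetExt r f) y = fderiv ℝ (jetExt r g) y := by
  rw [(hasFDerivAt_jetExt hf).fderiv, (hasFDerivAt_jetExt hg).fderiv]
  congr 2
  ext1 k
  -- The derivative of the `k`-th derivative is the `(k+1)`-st up to currying, and `k + 1 ≤ r + 1`;
  -- this is where one extra order of the jet is needed.
  rw [fderiv_iteratedFDeriv, fderiv_iteratedFDeriv, Function.comp_apply, Function.comp_apply,
    h (k + 1) (by omega)]

/-- The coordinate expression of `D_{r+1}`. -/
def horModel (n m r : ℕ) (z : JetModel n m (r + 1)) : JetModel n m r →L[ℝ] JetModel n m r :=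
  (fderiv ℝ (jetExt r (jetPoly z)) z.1).comp (ContinuousLinearMap.fst ℝ _ _)

/-- The Taylor polynomial is jointly smooth in its coefficients and its argument, hence so are its
prolongation and the derivative of the latter in the argument. -/
theorem contDiff_horModel (n m r : ℕ) : ContDiff ℝ ∞ (horModel n m r) := by
  refine contDiff_iff_contDiffAt.2 fun z => ?_
  refine ContDiffAt.clm_comp ?_ contDiffAt_const
  refine ContDiffAt.fderiv (f := fun z : JetModel n m (r + 1) => jetExt r (jetPoly z))
    (g := fun z => z.1) (n := ∞) ?_ contDiffAt_fst (by simp)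
  exact contDiffAt_jetExt_uncurry r contDiff_jetPoly.contDiffAt

end JetExt

/-! ### The projection to `M`, prolongations of sections and `D` in charts -/

section JetMaps

variable {n m : ℕ} {M E : Type*} [TopologicalSpace M] [ChartedSpace (Eu n) M]
  [TopologicalSpace E] [ChartedSpace (Eu (n + m)) E] {π : FibredManifold n m M E} {r : ℕ}

theorem JetSpace.toTotal_toLower (θ : JetSpace π (r + 1)) : θ.toLower.toTotal = θ.toTotal := by
  induction θ using Quotient.inductionOn; rfl

theorem JetSpace.toBase_toLower (θ : JetSpace π (r + 1)) : θ.toLower.toBase = θ.toBase := by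
  induction θ using Quotient.inductionOn; rfl

theorem JetSpace.base_rep (θ : JetSpace π r) : θ.rep.base = θ.toBase := by
  conv_rhs => rw [← θ.jet_rep]
  rfl

theorem AdaptedChart.base_symm_jetCoord (c : AdaptedChart π) {θ : JetSpace π r}
    (hθ : θ.toTotal ∈ c.total.source) : c.base.symm (c.jetCoord r θ).1 = θ.toBase := by
  rw [← θ.base_rep]
  exact c.base_symm_base (θ.value_rep ▸ hθ)

variable [IsManifold (𝓡 n) ∞ M] [IsManifold (𝓡 (n + m)) ∞ E]

theorem JetSpace.eventually_mem_source (θ₀ : JetSpace π r) :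
    ∀ᶠ θ in 𝓝 θ₀, θ.toTotal ∈ (adaptedChartAt π θ₀.toTotal).total.source :=
  (chartAt (JetModel n m r) θ₀).open_source.mem_nhds (mem_chart_source _ θ₀)

/-- In a jet chart the projection is the first coordinate followed by the inverse of the base chart.
-/
theorem JetSpace.contMDiff_toBase :
    ContMDiff 𝓘(ℝ, JetModel n m r) (𝓡 n) ∞ (JetSpace.toBase (π := π) (r := r)) := by
  intro θ₀
  let c := adaptedChartAt π θ₀.toTotal
  have h0 : θ₀.toTotal ∈ c.total.source := mem_adaptedChartAt_source π _
  have hz := (c.jetCoord_mem_target θ₀ h0).1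
  have h1 : ContMDiffAt 𝓘(ℝ, JetModel n m r) 𝓘(ℝ, Eu n) ∞
      (fun θ => (extChartAt 𝓘(ℝ, JetModel n m r) θ₀ θ).1) θ₀ :=
    (contDiff_fst.contMDiff.contMDiffAt).comp θ₀ contMDiffAt_extChartAt
  have h2 : ContMDiffAt 𝓘(ℝ, Eu n) (𝓡 n) ∞ c.base.symm
      ((extChartAt 𝓘(ℝ, JetModel n m r) θ₀ θ₀).1) :=
    c.smooth_base_symm.contMDiffAt (c.base.open_target.mem_nhds (c.fst_mem_target hz).1)
  refine (ContMDiffAt.comp θ₀ h2 h1).congr_of_eventuallyEq ?_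
  filter_upwards [θ₀.eventually_mem_source] with θ hθ
  exact (c.base_symm_jetCoord hθ).symm

namespace AdaptedChart

variable (c : AdaptedChart π)

/-- Being a section near a point is an open condition, so the junk branch of `prolong` is avoided on
a whole neighbourhood and derivatives of `prolong` make sense. -/
theorem eventually_jetCoord_prolong {g : LocalSection π} (hg : g.value ∈ c.total.source) :
    ∀ᶠ x in 𝓝 g.base, (g.prolong r x).toTotal ∈ c.total.source ∧ (g.prolong r x).toBase = x ∧
      c.jetCoord r (g.prolong r x) = jetExt r (c.localRep g) (c.base x) := by
  filter_upwards [g.isSection.eventually_nhds, c.eventually_mem hg] with x hx hxc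
  have hx : IsSectionNear π g.toFun x := hx
  rw [LocalSection.prolong, dif_pos hx]
  exact ⟨hxc, rfl, c.jetCoord_jet (g := ⟨x, g.toFun, hx⟩) hxc⟩

end AdaptedChart

theorem LocalSection.contMDiffAt_prolong (g : LocalSection π) (r : ℕ) :
    ContMDiffAt (𝓡 n) 𝓘(ℝ, JetModel n m r) ∞ (g.prolong r) g.base := by
  let θ₀ := g.prolong r g.base
  have hθ₀ : θ₀.toTotal = g.value := by
    simp only [θ₀, LocalSection.prolong, dif_pos g.isSection]; rfl
  let c := adaptedChartAt π θ₀.toTotal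
  have hg : g.value ∈ c.total.source := hθ₀ ▸ mem_adaptedChartAt_source π θ₀.toTotal
  have hb := c.base_mem hg
  have hev := c.eventually_jetCoord_prolong (r := r) hg
  have h1 : ContMDiffAt (𝓡 n) 𝓘(ℝ, Eu n) ∞ c.base g.base :=
    c.smooth_base.contMDiffAt (c.base.open_source.mem_nhds hb)
  have h2 : ContMDiffAt 𝓘(ℝ, Eu n) 𝓘(ℝ, JetModel n m r) ∞ (jetExt r (c.localRep g))
      (c.base g.base) :=
    (contDiffAt_jetExt (c.smooth_localRep hg).self_of_nhds).contMDiffAt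
  have h3 : jetExt r (c.localRep g) (c.base g.base) = extChartAt 𝓘(ℝ, JetModel n m r) θ₀ θ₀ :=
    hev.self_of_nhds.2.2.symm
  have h4 : ContMDiffAt 𝓘(ℝ, JetModel n m r) 𝓘(ℝ, JetModel n m r) ∞
      (extChartAt 𝓘(ℝ, JetModel n m r) θ₀).symm (jetExt r (c.localRep g) (c.base g.base)) := by
    rw [h3]
    exact (contMDiffOn_extChartAt_symm θ₀).contMDiffAt (extChartAt_target_mem_nhds θ₀)
  refine (ContMDiffAt.comp g.base h4 (ContMDiffAt.comp g.base h2 h1)).congr_of_eventuallyEq ?_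
  filter_upwards [hev] with x hx
  rw [Function.comp_apply, Function.comp_apply, ← hx.2.2]
  refine ((extChartAt 𝓘(ℝ, JetModel n m r) θ₀).left_inv ?_).symm
  rw [extChartAt_source]
  exact hx.1

theorem JetSpace.contMDiffAt_rep_prolong (θ : JetSpace π (r + 1)) :
    ContMDiffAt (𝓡 n) 𝓘(ℝ, JetModel n m r) ∞ (θ.rep.prolong r) θ.toBase :=
  θ.base_rep ▸ θ.rep.contMDiffAt_prolong r

/-- The chain rule applied to `π^r ∘ j_r s = id`. The equation is only available near the base point
of `θ`, which suffices for the derivative there. -/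
theorem tangentProj_contactMap (θ : JetSpace π (r + 1)) (v : TangentSpace (𝓡 n) θ.toBase) :
    tangentProj θ (contactMap θ v) = v := by
  have h1 := mfderiv_comp_apply_of_eq (I := 𝓡 n) (I' := 𝓘(ℝ, JetModel n m r)) (I'' := 𝓡 n)
    θ.toBase (f := θ.rep.prolong r) (g := JetSpace.toBase) (y := θ.toLower)
    ((JetSpace.contMDiff_toBase θ.toLower).mdifferentiableAt (by simp))
    (θ.contMDiffAt_rep_prolong.mdifferentiableAt (by simp)) θ.prolong_rep.1 v
  have h2 : JetSpace.toBase ∘ θ.rep.prolong r =ᶠ[𝓝 θ.toBase] id := by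
    rw [← θ.base_rep]
    filter_upwards [(adaptedChartAt π θ.rep.value).eventually_jetCoord_prolong (r := r)
      (mem_adaptedChartAt_source π _)] with x hx
    exact hx.2.1
  refine Eq.trans h1.symm ?_
  rw [h2.mfderiv_eq, mfderiv_id]
  rfl

/-- The coordinate expression of `D_{r+1}` in the trivialization of `TJ^r π` around a point. -/
theorem JetSpace.eventually_horEnd_eq (θ₀ : JetSpace π (r + 1)) :
    ∀ᶠ θ in 𝓝 θ₀, ∀ w : JetModel n m r,
      (trivializationAt (JetModel n m r) (TangentSpace 𝓘(ℝ, JetModel n m r))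
        θ₀.toLower).continuousLinearMapAt ℝ θ.toLower (horEnd θ
          ((trivializationAt (JetModel n m r) (TangentSpace 𝓘(ℝ, JetModel n m r))
            θ₀.toLower).symmL ℝ θ.toLower w)) =
        horModel n m r (extChartAt 𝓘(ℝ, JetModel n m (r + 1)) θ₀ θ) w := by
  filter_upwards [θ₀.eventually_mem_source] with θ hθ w
  let c := adaptedChartAt π θ₀.toLower.toTotal
  -- The preferred charts of `J^{r+1} π` at `θ₀` and of `J^r π` at its projection come from the same
  -- adapted chart, because both jets lie over the same point of `E`.
  have hc : c = adaptedChartAt π θ₀.toTotal := by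
    simp only [c, θ₀.toTotal_toLower]
  rw [← hc] at hθ
  have hx : θ.toLower ∈ (chartAt (JetModel n m r) θ₀.toLower).source := by
    change θ.toLower.toTotal ∈ c.total.source
    rwa [θ.toTotal_toLower]
  let e := extChartAt 𝓘(ℝ, JetModel n m r) θ₀.toLower
  have hxe : θ.toLower ∈ e.source := by rwa [extChartAt_source]
  have hg : θ.rep.value ∈ c.total.source := θ.value_rep ▸ hθ
  have hz : extChartAt 𝓘(ℝ, JetModel n m (r + 1)) θ₀ θ = c.jetCoord (r + 1) θ := by
    rw [hc]; rfl
  have hz1 : (e θ.toLower).1 = c.base θ.toBase := by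
    change c.base θ.toLower.rep.base = _
    rw [θ.toLower.base_rep, θ.toBase_toLower]
  have ht : e.target ∈ 𝓝 (e θ.toLower) := extChartAt_target_mem_nhds' (e.map_source hxe)
  -- The trivialization is the derivative of the chart `e`, so the conjugated `D` is the derivative
  -- of `e ∘ j_r s ∘ π^r ∘ e⁻¹`. The chain rule is applied three times, through `m1`, `m2` and `m3`.
  rw [TangentBundle.continuousLinearMapAt_trivializationAt hx,
    TangentBundle.symmL_trivializationAt hx, modelWithCornersSelf_coe, range_id, mfderivWithin_univ]
  have d1 : MDifferentiableAt 𝓘(ℝ, JetModel n m r) 𝓘(ℝ, JetModel n m r) e.symm (e θ.toLower) :=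
    ((contMDiffOn_extChartAt_symm (n := ∞) θ₀.toLower).contMDiffAt ht).mdifferentiableAt (by simp)
  have d2 : MDifferentiableAt 𝓘(ℝ, JetModel n m r) (𝓡 n) (JetSpace.toBase (π := π)) θ.toLower :=
    (JetSpace.contMDiff_toBase θ.toLower).mdifferentiableAt (by simp)
  have d3 : MDifferentiableAt (𝓡 n) 𝓘(ℝ, JetModel n m r) (θ.rep.prolong r) θ.toBase :=
    θ.contMDiffAt_rep_prolong.mdifferentiableAt (by simp)
  have d4 : MDifferentiableAt 𝓘(ℝ, JetModel n m r) 𝓘(ℝ, JetModel n m r) e θ.toLower :=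
    (contMDiffAt_extChartAt' (n := ∞) hx).mdifferentiableAt (by simp)
  have e1 : e.symm (e θ.toLower) = θ.toLower := e.left_inv hxe
  have e2 : (JetSpace.toBase ∘ e.symm) (e θ.toLower) = θ.toBase := by
    rw [Function.comp_apply, e1, θ.toBase_toLower]
  have e3 : (θ.rep.prolong r ∘ JetSpace.toBase ∘ e.symm) (e θ.toLower) = θ.toLower := by
    rw [Function.comp_apply, e2, θ.prolong_rep.1]
  have d12 : MDifferentiableAt 𝓘(ℝ, JetModel n m r) (𝓡 n) (JetSpace.toBase (π := π) ∘ e.symm)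
      (e θ.toLower) := MDifferentiableAt.comp_of_eq _ d2 d1 e1
  have d123 : MDifferentiableAt 𝓘(ℝ, JetModel n m r) 𝓘(ℝ, JetModel n m r)
      (θ.rep.prolong r ∘ JetSpace.toBase ∘ e.symm) (e θ.toLower) :=
    MDifferentiableAt.comp_of_eq _ d3 d12 e2
  have m1 := mfderiv_comp_apply_of_eq _ d2 d1 e1 w
  have m2 := mfderiv_comp_apply_of_eq _ d3 d12 e2 w
  have m3 := mfderiv_comp_apply_of_eq _ d4 d123 e3 w
  -- In coordinates `π^r` is `Prod.fst` and `j_r s` is the prolongation of the local representative.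
  have hev : e ∘ θ.rep.prolong r ∘ JetSpace.toBase ∘ e.symm =ᶠ[𝓝 (e θ.toLower)]
      jetExt r (c.localRep θ.rep) ∘ Prod.fst := by
    have hb : θ.rep.base = (JetSpace.toBase ∘ e.symm) (e θ.toLower) := by rw [e2, θ.base_rep]
    have h1 := d12.continuousAt.eventually
      (hb ▸ c.eventually_jetCoord_prolong (r := r) hg)
    filter_upwards [h1, ht] with z hz hzt
    refine hz.2.2.trans ?_
    have hs := e.map_target hzt
    rw [extChartAt_source] at hs
    have h2 := c.base_symm_jetCoord (θ := e.symm z) hs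
    have h3 : c.jetCoord r (e.symm z) = z := e.right_inv hzt
    have h4 : z ∈ c.jetTarget r := by
      have := (c.jetCoord_mem_target (e.symm z) hs).1
      rwa [h3] at this
    rw [h3] at h2
    rw [Function.comp_apply, Function.comp_apply, ← h2, c.base.right_inv (c.fst_mem_target h4).1]
  have hsm : ContDiffAt ℝ ∞ (c.localRep θ.rep) (c.base θ.toBase) :=
    θ.base_rep ▸ (c.smooth_localRep hg).self_of_nhds
  have hfd : fderiv ℝ (jetExt r (c.localRep θ.rep) ∘ Prod.fst) (e θ.toLower) w =
      horModel n m r (extChartAt 𝓘(ℝ, JetModel n m (r + 1)) θ₀ θ) w := by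
    have hd : HasFDerivAt (jetExt r (c.localRep θ.rep))
        (fderiv ℝ (jetExt r (c.localRep θ.rep)) (e θ.toLower).1) (e θ.toLower).1 := by
      rw [hz1]
      exact ((contDiffAt_jetExt hsm).differentiableAt (by simp)).hasFDerivAt
    rw [(hd.comp _ hasFDerivAt_fst).fderiv, hz1, hz, horModel]
    have hj := c.sameJet_jetPoly θ hθ
    have h5 : (c.jetCoord (r + 1) θ).1 = c.base θ.toBase := congrArg c.base θ.base_rep
    rw [θ.base_rep] at hj
    -- The chosen representative has the same `(r+1)`-jet as the Taylor polynomial and can be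
    -- exchanged for it.
    rw [h5, hj.fderiv_jetExt_eq hsm
      (contDiff_snd.comp (contDiff_jetPoly_graph _)).contDiffAt]
  refine Eq.trans ?_ hfd
  rw [← hev.fderiv_eq, ← mfderiv_eq_fderiv]
  refine Eq.trans ?_ m3.symm
  refine congrArg _ ?_
  refine Eq.trans ?_ m2.symm
  exact congrArg (contactMap θ) m1.symm

end JetMaps

/-! ### Smooth dependence of symmetric products on their arguments -/

section SymProdSmooth

/-- Inserting `S ∘ L = id` after each `A i` moves the symmetric product into the trivialization; a
one-sided inverse is enough. -/
theorem symProdEnd_compContinuousLinearMap {V W : Type*} [AddCommGroup V] [Module ℝ V]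
    [TopologicalSpace V] [AddCommGroup W] [Module ℝ W] [TopologicalSpace W] {k : ℕ}
    (A : Fin k → V →L[ℝ] V) (α : V [⋀^Fin k]→L[ℝ] ℝ) {S : W →L[ℝ] V} {L : V →L[ℝ] W}
    (h : ∀ v, S (L v) = v) : (symProdEnd A α).compContinuousLinearMap S =
      symProdEnd (fun i => L.comp ((A i).comp S)) (α.compContinuousLinearMap S) := by
  ext v
  rw [ContinuousAlternatingMap.compContinuousLinearMap_apply, symProdEnd_apply, symProdEnd_apply]
  simp [h, Function.comp_def]

variable {X : Type*} [NormedAddCommGroup X] [NormedSpace ℝ X]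

/-- Alternatization of multilinear forms on a normed space, as a continuous linear map. -/
def alternatizationL (X : Type*) [NormedAddCommGroup X] [NormedSpace ℝ X] (k : ℕ) :
    (X [×k]→L[ℝ] ℝ) →L[ℝ] (X [⋀^Fin k]→L[ℝ] ℝ) :=
  LinearMap.mkContinuous
    { toFun := fun f => ContinuousMultilinearMap.alternatization f
      map_add' := map_add _
      map_smul' := fun c f => by
        ext v
        simp only [ContinuousMultilinearMap.alternatization_apply_apply, smul_apply,
          ContinuousAlternatingMap.smul_apply, RingHom.id_apply, Finset.smul_sum]
        exact Finset.sum_congr rfl fun σ _ => smul_comm _ _ _ }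
    k.factorial fun f => by
      refine ContinuousAlternatingMap.opNorm_le_bound _ (by positivity) fun v => ?_
      change ‖ContinuousMultilinearMap.alternatization f v‖ ≤ _
      rw [ContinuousMultilinearMap.alternatization_apply_apply]
      refine (norm_sum_le _ _).trans ?_
      have h : ∀ σ : Equiv.Perm (Fin k), ‖Equiv.Perm.sign σ • f (v ∘ σ)‖ ≤ ‖f‖ * ∏ i, ‖v i‖ := by
        intro σ
        have h1 : ‖Equiv.Perm.sign σ • f (v ∘ σ)‖ = ‖f (v ∘ σ)‖ := by
          rcases Int.units_eq_one_or (Equiv.Perm.sign σ) with h | h <;> simp [h]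
        rw [h1, ← Equiv.prod_comp σ]
        exact f.le_opNorm _
      refine (Finset.sum_le_sum fun σ _ => h σ).trans ?_
      rw [Finset.sum_const, Finset.card_univ, Fintype.card_perm, Fintype.card_fin, nsmul_eq_mul,
        mul_assoc]

/-- The expression is multilinear in the endomorphisms, linear in the form, and followed by a
continuous linear map, alternatization. -/
theorem contDiff_symProdEnd (k : ℕ) : ContDiff ℝ ∞
    (fun w : (Fin k → X →L[ℝ] X) × (X [⋀^Fin k]→L[ℝ] ℝ) => symProdEnd w.1 w.2) := by
  have h1 : ContDiff ℝ ∞ (fun A : Fin k → X →L[ℝ] X =>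
      ContinuousMultilinearMap.compContinuousLinearMapContinuousMultilinear ℝ
        (fun _ : Fin k => X) (fun _ : Fin k => X) ℝ A) :=
    ContinuousMultilinearMap.contDiff _
  have h2 : ContDiff ℝ ∞ (fun α : X [⋀^Fin k]→L[ℝ] ℝ => α.toContinuousMultilinearMap) :=
    (ContinuousAlternatingMap.toContinuousMultilinearMapLI
      (𝕜 := ℝ) (E := X) (F := ℝ) (ι := Fin k)).contDiff
  have h3 := (h1.comp contDiff_fst).clm_apply (h2.comp contDiff_snd)
    (f := fun w : (Fin k → X →L[ℝ] X) × (X [⋀^Fin k]→L[ℝ] ℝ) => _)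
  exact ((alternatizationL X k).contDiff.comp h3).const_smul (k.factorial : ℝ)⁻¹

theorem contDiff_symProdEnd_id_sub (k p : ℕ) : ContDiff ℝ ∞
    (fun w : (X →L[ℝ] X) × (X [⋀^Fin k]→L[ℝ] ℝ) => symProdEnd (fun i : Fin k =>
      if (i : ℕ) < p then ContinuousLinearMap.id ℝ X - w.1 else w.1) w.2) := by
  have h : ContDiff ℝ ∞ fun (w : (X →L[ℝ] X) × (X [⋀^Fin k]→L[ℝ] ℝ)) (i : Fin k) =>
      if (i : ℕ) < p then ContinuousLinearMap.id ℝ X - w.1 else w.1 := by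
    refine contDiff_pi.2 fun i => ?_
    by_cases hi : (i : ℕ) < p
    · simp only [if_pos hi]
      exact contDiff_const.sub contDiff_fst
    · simp only [if_neg hi]
      exact contDiff_fst
  exact ContDiff.comp (contDiff_symProdEnd (X := X) k)
    (f := fun w : (X →L[ℝ] X) × (X [⋀^Fin k]→L[ℝ] ℝ) =>
      (fun i : Fin k => if (i : ℕ) < p then ContinuousLinearMap.id ℝ X - w.1 else w.1, w.2))
    (h.prodMk contDiff_snd)

end SymProdSmooth

/-! ### Direct sums from families of projections -/

section InternalProjections

variable {R N ι : Type*} [CommRing R] [AddCommGroup N] [Module R N] [DecidableEq ι] [Fintype ι]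
  {A : ι → Submodule R N} {P : ι → N →ₗ[R] N}

/-- On `A i` all `P j` with `j ≠ i` vanish and the sum is the identity, so `P i` is the identity
there. It therefore reads off the `i`-th component, which yields both independence and the formula
for the projection. -/
theorem proj_coeLinearMap (hsum : ∀ x, ∑ i, P i x = x)
    (hzero : ∀ i j, i ≠ j → ∀ x ∈ A j, P i x = 0) (d : DirectSum ι fun i => A i) (i : ι) :
    P i (DirectSum.coeLinearMap A d) = d i := by
  induction d using DirectSum.induction_on with
  | zero => simp
  | of j x =>
    rw [DirectSum.coeLinearMap_of]
    by_cases h : i = j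
    · subst h
      rw [DirectSum.of_eq_same]
      conv_rhs => rw [← hsum (x : N)]
      exact (Finset.sum_eq_single i (fun j _ hj => hzero j i hj x x.2) (by simp)).symm
    · rw [hzero i j h x x.2, DirectSum.of_eq_of_ne _ _ _ h]; rfl
  | add x y hx hy => simp [hx, hy]

theorem isInternal_of_projections (hmem : ∀ i x, P i x ∈ A i) (hsum : ∀ x, ∑ i, P i x = x)
    (hzero : ∀ i j, i ≠ j → ∀ x ∈ A j, P i x = 0) : DirectSum.IsInternal A := by
  refine ⟨?_, fun x => ⟨∑ i, DirectSum.of (fun i => A i) i ⟨P i x, hmem i x⟩, ?_⟩⟩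
  · refine (injective_iff_map_eq_zero _).2 fun d hd => ?_
    ext i
    have h := proj_coeLinearMap hsum hzero d i
    rw [← h]
    exact (congrArg (P i) hd).trans (map_zero _)
  · rw [map_sum]
    simp only [DirectSum.coeAddMonoidHom_of]
    exact hsum x

theorem internalProj_eq (hsum : ∀ x, ∑ i, P i x = x)
    (hzero : ∀ i j, i ≠ j → ∀ x ∈ A j, P i x = 0) (h : DirectSum.IsInternal A) (i : ι) (x : N) :
    internalProj h i x = P i x := by
  let e := LinearEquiv.ofBijective (DirectSum.coeLinearMap A) h
  have h1 : DirectSum.coeLinearMap A (e.symm x) = x := e.apply_symm_apply x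
  have h2 := proj_coeLinearMap hsum hzero (e.symm x) i
  rw [h1] at h2
  exact h2.symm

end InternalProjections

/-! ### The contact splitting of forms on jet spaces -/

section ContactSplitting

variable {n m : ℕ} {M E : Type*} [TopologicalSpace M] [ChartedSpace (Eu n) M]
  [TopologicalSpace E] [ChartedSpace (Eu (n + m)) E] [IsManifold (𝓡 n) ∞ M]
  [IsManifold (𝓡 (n + m)) ∞ E] {π : FibredManifold n m M E} {r : ℕ}

instance JetTangent.finiteDimensional (θ : JetSpace π (r + 1)) :
    FiniteDimensional ℝ (JetTangent θ) :=
  inferInstanceAs (FiniteDimensional ℝ (JetModel n m r))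

instance JetTangent.t2Space (θ : JetSpace π (r + 1)) : T2Space (JetTangent θ) :=
  inferInstanceAs (T2Space (JetModel n m r))

theorem contactEnd_apply (θ : JetSpace π (r + 1)) (v : JetTangent θ) :
    contactEnd θ v = v - horEnd θ v := rfl

theorem tangentProj_horEnd (θ : JetSpace π (r + 1)) (v : JetTangent θ) :
    tangentProj θ (horEnd θ v) = tangentProj θ v := tangentProj_contactMap θ _

theorem tangentProj_contactEnd (θ : JetSpace π (r + 1)) (v : JetTangent θ) :
    tangentProj θ (contactEnd θ v) = 0 := by
  rw [contactEnd_apply, map_sub, tangentProj_horEnd, sub_self]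

theorem horEnd_horEnd (θ : JetSpace π (r + 1)) (v : JetTangent θ) :
    horEnd θ (horEnd θ v) = horEnd θ v := congrArg (contactMap θ) (tangentProj_horEnd θ v)

theorem horEnd_contactEnd (θ : JetSpace π (r + 1)) (v : JetTangent θ) :
    horEnd θ (contactEnd θ v) = 0 := by
  rw [contactEnd_apply, map_sub, horEnd_horEnd, sub_self]

theorem contactEnd_horEnd (θ : JetSpace π (r + 1)) (v : JetTangent θ) :
    contactEnd θ (horEnd θ v) = 0 := by
  rw [contactEnd_apply, horEnd_horEnd, sub_self]

theorem contactEnd_add_horEnd (θ : JetSpace π (r + 1)) (v : JetTangent θ) :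
    contactEnd θ v + horEnd θ v = v := by
  rw [contactEnd_apply, sub_add_cancel]

section Fibres
variable (θ : JetSpace π (r + 1))

theorem comp_contactEnd_mem (β : JetTangent θ →L[ℝ] ℝ) :
    β.comp (contactEnd θ) ∈ contactFibre θ := ⟨β, rfl⟩

theorem comp_horEnd_mem (β : JetTangent θ →L[ℝ] ℝ) :
    β.comp (horEnd θ) ∈ horizontalFibre θ := ⟨β.comp (contactMap θ), rfl⟩

theorem comp_horEnd_eq_zero : ∀ β ∈ contactFibre θ, β.comp (horEnd θ) = 0 := by
  rintro _ ⟨β, rfl⟩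
  ext v
  exact (congrArg β (contactEnd_horEnd θ v)).trans (map_zero β)

theorem comp_contactEnd_eq_zero : ∀ β ∈ horizontalFibre θ, β.comp (contactEnd θ) = 0 := by
  rintro _ ⟨β, rfl⟩
  ext v
  exact (congrArg β (tangentProj_contactEnd θ v)).trans (map_zero β)

theorem comp_contactEnd_eq_self : ∀ β ∈ contactFibre θ, β.comp (contactEnd θ) = β := by
  intro β hβ
  ext v
  have h := congrArg (fun γ : JetTangent θ →L[ℝ] ℝ => γ v) (comp_horEnd_eq_zero θ β hβ)
  have h' : β (horEnd θ v) = 0 := h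
  change β (contactEnd θ v) = β v
  rw [contactEnd_apply, map_sub, h', sub_zero]

/-- Together with `comp_horEnd_mem`, this identifies the covectors pulled back from `M` with the
image of the transpose of `D`. -/
theorem comp_horEnd_eq_self : ∀ β ∈ horizontalFibre θ, β.comp (horEnd θ) = β := by
  rintro _ ⟨β, rfl⟩
  ext v
  exact congrArg β (tangentProj_horEnd θ v)

end Fibres

/-- The operators `⊙_p ω_{r+1} ⊙ ⊙_{k-p} D_{r+1}` preserve smoothness. -/
theorem RoughForm.IsSmooth.symProdEnd {k : ℕ} {α : RoughForm π r k} (hα : α.IsSmooth) (p : ℕ) :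
    RoughForm.IsSmooth (fun θ => symProdEnd
      (fun i : Fin k => if (i : ℕ) < p then contactEnd θ else horEnd θ) (α θ) :
        RoughForm π r k) := by
  intro θ₀
  let e := extChartAt 𝓘(ℝ, JetModel n m (r + 1)) θ₀
  let D : JetSpace π (r + 1) → JetModel n m r →L[ℝ] JetModel n m r := fun θ =>
    horModel n m r (e θ)
  have hD : ContMDiffAt 𝓘(ℝ, JetModel n m (r + 1)) 𝓘(ℝ, JetModel n m r →L[ℝ] JetModel n m r) ∞
      D θ₀ :=
    (contDiff_horModel n m r).contMDiff.contMDiffAt.comp θ₀ contMDiffAt_extChartAt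
  have hG := contDiff_symProdEnd_id_sub (X := JetModel n m r) k p
  -- Near `θ₀` the local expression of the new form is a universal smooth function of the coordinate
  -- expression of `D` and the local expression of `α`.
  refine (hG.contMDiff.contMDiffAt.comp θ₀ (hD.prodMk_space (hα θ₀))).congr_of_eventuallyEq ?_
  filter_upwards [θ₀.eventually_horEnd_eq, θ₀.eventually_mem_source] with θ hθ hs
  let t := trivializationAt (JetModel n m r) (TangentSpace 𝓘(ℝ, JetModel n m r)) θ₀.toLower
  have hb : θ.toLower ∈ t.baseSet := by
    change θ.toLower.toTotal ∈ (adaptedChartAt π θ₀.toLower.toTotal).total.source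
    rwa [θ.toTotal_toLower, θ₀.toTotal_toLower]
  have h := symProdEnd_compContinuousLinearMap
    (fun i : Fin k => if (i : ℕ) < p then contactEnd θ else horEnd θ) (α θ)
    (t.symmL_continuousLinearMapAt (R := ℝ) hb)
  refine h.trans ?_
  change _ = _root_.symProdEnd _ _
  congr 1
  ext1 i
  refine ContinuousLinearMap.ext fun w => ?_
  change t.continuousLinearMapAt ℝ θ.toLower
    ((if (i : ℕ) < p then contactEnd θ else horEnd θ) (t.symmL ℝ θ.toLower w)) = _
  split_ifs
  · rw [contactEnd_apply, map_sub, t.continuousLinearMapAt_symmL hb]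
    exact congrArg (w - ·) (hθ w)
  · exact hθ w

/-- The operator `binom k p ⊙_p ω_{r+1} ⊙ ⊙_{k-p} D_{r+1}` on `Λ^k_{r+1,r}`. -/
def formProj (π : FibredManifold n m M E) (r k p : ℕ) :
    relForms π r k →ₗ[JetFun π (r + 1)] relForms π r k where
  toFun α := ⟨fun θ => splitProj (contactEnd θ) (horEnd θ) k p ((α : RoughForm π r k) θ),
    -- The binomial coefficient acts as a constant function of `𝓕_{r+1}`.
    (relForms π r k).smul_mem (⟨fun _ => (k.choose p : ℝ), contMDiff_const⟩ : JetFun π (r + 1))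
      (RoughForm.IsSmooth.symProdEnd α.2 p)⟩
  map_add' _ _ := Subtype.ext (funext fun _ => map_add (splitProj _ _ k p) _ _)
  map_smul' f α := Subtype.ext (funext fun θ =>
    map_smul (splitProj _ _ k p) (f θ) ((α : RoughForm π r k) θ))

theorem formProj_apply (k p : ℕ) (α : relForms π r k) (θ : JetSpace π (r + 1)) :
    (formProj π r k p α : RoughForm π r k) θ =
      splitProj (contactEnd θ) (horEnd θ) k p ((α : RoughForm π r k) θ) := rfl

theorem relForms_coe_sum {ι : Type*} (s : Finset ι) {k : ℕ} (f : ι → relForms π r k)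
    (θ : JetSpace π (r + 1)) : ((∑ i ∈ s, f i : relForms π r k) : RoughForm π r k) θ =
      ∑ i ∈ s, (f i : RoughForm π r k) θ := by
  let ev : relForms π r k →+ (JetTangent θ [⋀^Fin k]→L[ℝ] ℝ) :=
    { toFun := fun α => (α : RoughForm π r k) θ
      map_zero' := rfl
      map_add' := fun _ _ => rfl }
  exact map_sum ev f s

theorem sum_formProj (k : ℕ) (α : relForms π r k) :
    ∑ l : Fin (k + 1), formProj π r k (k - l) α = α := by
  refine Subtype.ext (funext fun θ => ?_)
  rw [relForms_coe_sum]
  exact sum_splitProj (contactEnd_add_horEnd θ) k _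

theorem formProj_mem_splittingSummand (k : ℕ) (l : Fin (k + 1)) (α : relForms π r k) :
    formProj π r k (k - l) α ∈ splittingSummand π r k l := fun θ =>
  splitProj_mem (Nat.sub_add_cancel (Nat.lt_succ_iff.1 l.2)) (comp_contactEnd_mem θ)
    (comp_horEnd_mem θ) _

theorem formProj_eq_zero (k : ℕ) (l j : Fin (k + 1)) (hlj : l ≠ j) (α : relForms π r k)
    (hα : α ∈ splittingSummand π r k j) : formProj π r k (k - l) α = 0 :=
  Subtype.ext (funext fun θ => splitProj_eq_zero _ (Nat.sub_le k l) (by omega)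
    (comp_horEnd_eq_zero θ) (comp_contactEnd_eq_zero θ) (hα θ))

theorem isCompl_contactForms_horizontalForms (π : FibredManifold n m M E) (r : ℕ) :
    IsCompl (contactForms π r 1) (horizontalForms π r 1) := by
  refine ⟨Submodule.disjoint_def.2 fun α hC hH => ?_, codisjoint_iff_le_sup.2 fun α _ => ?_⟩
  · refine Subtype.ext (funext fun θ => ?_)
    have h1 := compContinuousLinearMap_of_mem_extPower (comp_contactEnd_eq_self θ) (hC θ)
    have h2 := compContinuousLinearMap_of_mem_extPower (comp_horEnd_eq_self θ) (hH θ)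
    ext v
    -- Pull-back along both `ω` and `D` fixes the form, so its value at `v` is its value at `D (ω v)
    -- = 0`.
    rw [← h1, ← h2]
    exact ((α : RoughForm π r 1) θ).map_coord_zero 0 (horEnd_contactEnd θ (v 0))
  -- In degree one the two operators are the pull-backs along `ω` (`l = 0`) and along `D` (`l = 1`).
  · rw [← sum_formProj 1 α, Fin.sum_univ_two]
    refine Submodule.add_mem_sup (fun θ => ?_) fun θ => ?_
    · have h := compContinuousLinearMap_mem_extPower (comp_contactEnd_mem θ)
        ((α : RoughForm π r 1) θ)
      rw [← symProdEnd_const] at h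
      rw [formProj_apply, splitProj_apply]
      simpa using h
    · have h := compContinuousLinearMap_mem_extPower (comp_horEnd_mem θ)
        ((α : RoughForm π r 1) θ)
      rw [← symProdEnd_const] at h
      rw [formProj_apply, splitProj_apply]
      simpa using h

end ContactSplitting

end

theorem mainTheorem7 {n m : ℕ} {M E : Type*}
    [TopologicalSpace M] [ChartedSpace (Eu n) M] [IsManifold (𝓡 n) ∞ M]
    [TopologicalSpace E] [ChartedSpace (Eu (n + m)) E] [IsManifold (𝓡 (n + m)) ∞ E]
    (π : FibredManifold n m M E) (r k : ℕ) :
    IsCompl (contactForms π r 1) (horizontalForms π r 1) ∧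
    ∃ h : DirectSum.IsInternal (splittingSummand π r k),
      ∀ (l : Fin (k + 1)) (α : relForms π r k) (θ : JetSpace π (r + 1)),
        (internalProj h l α : RoughForm π r k) θ =
          (k.choose (k - l) : ℝ) • symProdEnd
            (fun i : Fin k => if (i : ℕ) < k - l then contactEnd θ else horEnd θ)
            ((α : RoughForm π r k) θ) :=
  ⟨isCompl_contactForms_horizontalForms π r,
    isInternal_of_projections (formProj_mem_splittingSummand k) (sum_formProj k)
      (formProj_eq_zero k),
    fun l α θ => by
      rw [internalProj_eq (sum_formProj k) (formProj_eq_zero k)]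
      rfl⟩
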